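/- Let $K$ be an algebraically closed field of characteristic $p>0$, let $q=p^n$ with $n\ge 1$, and let $m$ be an integer with $m\mid q+1$ and $2\le m<q$. Let $\hat{\mathcal F}_m$ be the smooth model of the plane curve $\mathcal F_m\subset\mathbb P^2$ over $K$ that is the projective closure of the affine curve $y^m=x^q+x$. For an irreducible plane curve $C\subset\mathbb P^2$, a point $P\in\mathbb P^2$ is called a Galois point for $C$ if the extension of function fields $K(C)/\pi_P^*K(\mathbb P^1)$ induced by the projection $\pi_P\colon C\dashrightarrow\mathbb P^1$ with center $P$ is Galois. A Galois point $P$ is called inner if $P$ is a smooth point of $C$, and outer if $P\notin C$. Then the following hold. (1) There exists a morphism $\varphi\colon\hat{\mathcal F}_m\to\mathbb P^2$, birational onto its image, such that $\varphi(\hat{\mathcal F}_m)$ is a plane curve of degree $q+1$ that has two distinct inner Galois points. (2) There exists a morphism $\psi\colon\hat{\mathcal F}_m\to\mathbb P^2$, birational onto its image, such that $\psi(\hat{\mathcal F}_m)$ is a plane curve of degree $q+1$ that has two distinct outer Galois points. -/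

import Mathlib

noncomputable section

open MvPolynomial

namespace GaloisPoints

/-- The projective plane over `K` (its set of `K`-points). -/
abbrev Plane (K : Type*) [Field K] : Type _ := Projectivization K (Fin 3 → K)

/-- An irreducible plane curve over `K` (meant for `K` algebraically closed), given by an
irreducible homogeneous polynomial in the coordinates `X = X 0`, `Y = X 1`, `Z = X 2`. -/
structure PlaneCurve (K : Type*) [Field K] where
  /-- the defining polynomial -/
  poly : MvPolynomial (Fin 3) K
  isHomogeneous : poly.IsHomogeneous poly.totalDegree
  irreducible : Irreducible poly

/-! ### The function field of a plane curve -/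

namespace PlaneCurve

variable {K : Type*} [Field K] (C : PlaneCurve K)

/-- The degree of a plane curve. -/
def degree : ℕ := C.poly.totalDegree

/-- The set of points of the curve in the projective plane. -/
def points : Set (Plane K) := {Q | eval Q.rep C.poly = 0}

/-- The homogeneous coordinate ring `K[X, Y, Z] / (G)`. -/
abbrev CoordinateRing : Type _ := MvPolynomial (Fin 3) K ⧸ Ideal.span {C.poly}

instance isPrime_span : (Ideal.span {C.poly}).IsPrime :=
  (Ideal.span_singleton_prime C.irreducible.ne_zero).2 C.irreducible.prime

instance isDomain_coordinateRing : IsDomain C.CoordinateRing :=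
  Ideal.Quotient.isDomain _

/-- The class of a polynomial in the field of fractions of the homogeneous coordinate ring. -/
def coord : MvPolynomial (Fin 3) K →ₐ[K] FractionRing C.CoordinateRing :=
  (IsScalarTower.toAlgHom K C.CoordinateRing (FractionRing C.CoordinateRing)).comp
    (Ideal.Quotient.mkₐ K (Ideal.span {C.poly}))

/-- The function field `K(C)`: the fractions `A / B` of homogeneous polynomials of the same degree,
`B` not vanishing identically on `C`, as a subfield of the field of fractions of the homogeneous
coordinate ring. -/
def functionField : IntermediateField K (FractionRing C.CoordinateRing) where
  carrier := {g | ∃ (n : ℕ) (A B : MvPolynomial (Fin 3) K), A.IsHomogeneous n ∧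
    B.IsHomogeneous n ∧ C.coord B ≠ 0 ∧ g = C.coord A / C.coord B}
  mul_mem' := by
    rintro _ _ ⟨n, A, B, hA, hB, hB0, rfl⟩ ⟨n', A', B', hA', hB', hB0', rfl⟩
    refine ⟨n + n', A * A', B * B', hA.mul hA', hB.mul hB', ?_, ?_⟩
    · rw [map_mul]
      exact mul_ne_zero hB0 hB0'
    · rw [map_mul, map_mul, div_mul_div_comm]
  add_mem' := by
    rintro _ _ ⟨n, A, B, hA, hB, hB0, rfl⟩ ⟨n', A', B', hA', hB', hB0', rfl⟩
    refine ⟨n + n', A * B' + B * A', B * B', (hA.mul hB').add (hB.mul hA'), hB.mul hB', ?_, ?_⟩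
    · rw [map_mul]
      exact mul_ne_zero hB0 hB0'
    · rw [map_add, map_mul, map_mul, map_mul, div_add_div _ _ hB0 hB0']
  algebraMap_mem' := by
    intro c
    refine ⟨0, MvPolynomial.C c, 1, isHomogeneous_C _ _, isHomogeneous_one _ _, ?_, ?_⟩
    · rw [map_one]
      exact one_ne_zero
    · rw [map_one, div_one]
      exact (C.coord.commutes c).symm
  inv_mem' := by
    rintro _ ⟨n, A, B, hA, hB, hB0, rfl⟩
    by_cases h : C.coord A = 0
    · exact ⟨0, 0, 1, isHomogeneous_zero _ _ _, isHomogeneous_one _ _, by simp, by simp [h]⟩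
    · exact ⟨n, B, A, hB, hA, h, by rw [inv_div]⟩

/-- The type of rational functions on `C`. -/
abbrev FunctionField : Type _ := ↥C.functionField

/-- The rational function `g` on `C` is regular at the point `Q` of `C` with value `c` there:
`g = A / B` with `A`, `B` homogeneous of the same degree, `B(Q) ≠ 0` and `c = A(Q) / B(Q)`. -/
def HasValueAt (g : C.FunctionField) (Q : Plane K) (c : K) : Prop :=
  ∃ (n : ℕ) (A B : MvPolynomial (Fin 3) K), A.IsHomogeneous n ∧ B.IsHomogeneous n ∧
    eval Q.rep B ≠ 0 ∧ (g : FractionRing C.CoordinateRing) = C.coord A / C.coord B ∧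
    c = eval Q.rep A / eval Q.rep B

/-! ### Galois points -/

/-- The subfield `π_P^* K(ℙ¹)` of `K(C)` for the projection `π_P` with centre `P`. In coordinates
`π_P` is `(ℓ₁ : ℓ₂)` for a basis `ℓ₁, ℓ₂` of the linear forms vanishing at `P`, so that this
subfield is generated by the quotients of such forms. -/
def projectionField (P : Plane K) : IntermediateField K C.FunctionField :=
  IntermediateField.adjoin K {g | ∃ l₁ l₂ : MvPolynomial (Fin 3) K,
    l₁.IsHomogeneous 1 ∧ l₂.IsHomogeneous 1 ∧ eval P.rep l₁ = 0 ∧ eval P.rep l₂ = 0 ∧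
    C.coord l₂ ≠ 0 ∧ (g : FractionRing C.CoordinateRing) = C.coord l₁ / C.coord l₂}

/-- `P` is a Galois point for `C` if `K(C) / π_P^* K(ℙ¹)` is a Galois extension. -/
def IsGaloisPoint (P : Plane K) : Prop := IsGalois (C.projectionField P) C.FunctionField

/-- `P` is a smooth point of `C`. -/
def IsSmoothPoint (P : Plane K) : Prop :=
  P ∈ C.points ∧ ∃ i : Fin 3, eval P.rep (pderiv i C.poly) ≠ 0

/-- Inner Galois points: those that are smooth points of `C`. -/
def IsInnerGaloisPoint (P : Plane K) : Prop := C.IsGaloisPoint P ∧ C.IsSmoothPoint P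

/-- Outer Galois points: those not contained in `C`. -/
def IsOuterGaloisPoint (P : Plane K) : Prop := C.IsGaloisPoint P ∧ P ∉ C.points

/-! ### The smooth model -/

/-- The smooth model of `C`, as the abstract nonsingular curve of its function field: its points
are the valuation rings `𝒪 ≠ K(C)` of `K(C)` that contain `K`, the local ring at such a point is
the ring itself, and the nonempty open sets are the cofinite ones. -/
def SmoothModel : Type _ :=
  {v : ValuationSubring C.FunctionField // (∀ c : K, algebraMap K C.FunctionField c ∈ v) ∧ v ≠ ⊤}

variable {C}

/-- The rational function `f` is regular at the point `R` of the smooth model with value `c` there,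
that is, `f - c` lies in the maximal ideal of the valuation ring. -/
def SmoothModel.HasValueAt (f : C.FunctionField) (R : C.SmoothModel) (c : K) : Prop :=
  R.1.valuation (f - algebraMap K C.FunctionField c) < 1

/-- A map from the smooth model to the projective plane is a morphism if around every point it is
given, on an open neighbourhood `U`, by three regular functions without a common zero. -/
def SmoothModel.IsMorphism (φ : C.SmoothModel → Plane K) : Prop :=
  ∀ R₀ : C.SmoothModel, ∃ U : Set C.SmoothModel, R₀ ∈ U ∧ Uᶜ.Finite ∧
    ∃ f : Fin 3 → C.FunctionField, ∀ R ∈ U, ∃ (c : Fin 3 → K) (hc : c ≠ 0),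
      (∀ i, SmoothModel.HasValueAt (f i) R (c i)) ∧ φ R = Projectivization.mk K c hc

/-- `φ` has as its image the plane curve `D` and is birational onto it: the points of `D` are the
values of `φ`, and the pullback of rational functions along `φ` is an isomorphism
`σ : K(D) ≃ K(C)`. That `σ` is the pullback means that a rational function `g`, regular at `φ(R)`
with value `c`, has as its image `σ g` a function that is regular at `R` with value `c`. -/
def SmoothModel.IsBirationalOnto (φ : C.SmoothModel → Plane K) (D : PlaneCurve K) : Prop :=
  Set.range φ = D.points ∧
    ∃ σ : D.FunctionField ≃ₐ[K] C.FunctionField, ∀ (g : D.FunctionField) (R : C.SmoothModel)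
      (c : K), D.HasValueAt g (φ R) c → SmoothModel.HasValueAt (σ g) R c

end PlaneCurve

/-! ### The curve `y ^ m = x ^ q + x` -/

/-- The homogenization of `y ^ m - (x ^ q + x)`, for `m < q`. -/
def artinSchreierPoly (K : Type*) [Field K] (q m : ℕ) : MvPolynomial (Fin 3) K :=
  X 1 ^ m * X 2 ^ (q - m) - (X 0 ^ q + X 0 * X 2 ^ (q - 1))

theorem artinSchreierPoly_isHomogeneous (K : Type*) [Field K] {q m : ℕ} (hmq : m < q) :
    (artinSchreierPoly K q m).IsHomogeneous q := by
  have h1 : ((X 1 : MvPolynomial (Fin 3) K) ^ m * X 2 ^ (q - m)).IsHomogeneous q := by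
    have := (isHomogeneous_X_pow (R := K) (1 : Fin 3) m).mul
      (isHomogeneous_X_pow (R := K) (2 : Fin 3) (q - m))
    rwa [Nat.add_sub_cancel' hmq.le] at this
  have h2 : ((X 0 : MvPolynomial (Fin 3) K) * X 2 ^ (q - 1)).IsHomogeneous q := by
    have := (isHomogeneous_X K (0 : Fin 3)).mul (isHomogeneous_X_pow (R := K) (2 : Fin 3) (q - 1))
    rwa [Nat.add_sub_cancel' (by omega)] at this
  exact h1.sub ((isHomogeneous_X_pow _ _).add h2)

theorem artinSchreierPoly_irreducible (K : Type*) [Field K] {q m : ℕ} (hm : 2 ≤ m) (hmq : m < q) :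
    Irreducible (artinSchreierPoly K q m) := by
  -- Eisenstein's criterion in the variable `Y`, at the prime `X`
  let e : MvPolynomial (Fin 3) K ≃ₐ[K] Polynomial (MvPolynomial (Fin 2) K) :=
    (renameEquiv K (Equiv.swap (0 : Fin 3) 1)).trans (finSuccEquiv K 2)
  have e0 : e (X 0) = Polynomial.C (X 0) := by
    have : (1 : Fin 3) = Fin.succ 0 := rfl
    simp only [e, AlgEquiv.trans_apply, renameEquiv_apply, rename_X, Equiv.swap_apply_left]
    rw [this, finSuccEquiv_X_succ]
  have e1 : e (X 1) = Polynomial.X := by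
    simp only [e, AlgEquiv.trans_apply, renameEquiv_apply, rename_X, Equiv.swap_apply_right]
    rw [finSuccEquiv_X_zero]
  have e2 : e (X 2) = Polynomial.C (X 1) := by
    have : Equiv.swap (0 : Fin 3) 1 2 = Fin.succ 1 := by decide
    simp only [e, AlgEquiv.trans_apply, renameEquiv_apply, rename_X]
    rw [this, finSuccEquiv_X_succ]
  set a : MvPolynomial (Fin 2) K := X 1 ^ (q - m) with ha
  set b : MvPolynomial (Fin 2) K := X 0 ^ q + X 0 * X 1 ^ (q - 1) with hb
  have heq : e (artinSchreierPoly K q m)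
      = Polynomial.C a * Polynomial.X ^ m - Polynomial.C b := by
    simp only [artinSchreierPoly, map_sub, map_add, map_mul, map_pow, e0, e1, e2, ha, hb]
    ring
  rw [← MulEquiv.irreducible_iff e.toMulEquiv]
  change Irreducible (e (artinSchreierPoly K q m))
  rw [heq]
  have ha0 : a ≠ 0 := pow_ne_zero _ (X_ne_zero _)
  have hdeg : (Polynomial.C a * Polynomial.X ^ m - Polynomial.C b).degree = (m : WithBot ℕ) := by
    rw [Polynomial.degree_sub_eq_left_of_degree_lt, Polynomial.degree_C_mul_X_pow _ ha0]
    rw [Polynomial.degree_C_mul_X_pow _ ha0]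
    exact lt_of_le_of_lt Polynomial.degree_C_le (by exact_mod_cast (by omega : 0 < m))
  have hcoeff : ∀ n, (Polynomial.C a * Polynomial.X ^ m - Polynomial.C b).coeff n
      = (if n = m then a else 0) - (if n = 0 then b else 0) := by
    intro n
    rw [Polynomial.coeff_sub, Polynomial.coeff_C_mul_X_pow, Polynomial.coeff_C]
  have hnd := Polynomial.natDegree_eq_of_degree_eq_some hdeg
  have hlead : (Polynomial.C a * Polynomial.X ^ m - Polynomial.C b).leadingCoeff = a := by
    rw [Polynomial.leadingCoeff, hnd, hcoeff]
    simp [show m ≠ 0 by omega]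
  have hp0 : Prime (X 0 : MvPolynomial (Fin 2) K) := X_prime
  have hp1 : Prime (X 1 : MvPolynomial (Fin 2) K) := X_prime
  have h01 : ¬ (X 0 : MvPolynomial (Fin 2) K) ∣ X 1 := by
    rw [X_dvd_X]; simp
  have h10 : ¬ (X 1 : MvPolynomial (Fin 2) K) ∣ X 0 := by
    rw [X_dvd_X]; simp
  refine Polynomial.irreducible_of_eisenstein_criterion
    (P := Ideal.span {(X 0 : MvPolynomial (Fin 2) K)})
    ((Ideal.span_singleton_prime hp0.ne_zero).2 hp0) ?_ ?_ ?_ ?_ ?_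
  · rw [hlead, Ideal.mem_span_singleton]
    exact fun h => h01 (hp0.dvd_of_dvd_pow h)
  · intro n hn
    rw [hdeg] at hn
    have hn' : n < m := by exact_mod_cast hn
    rw [hcoeff, if_neg hn'.ne, zero_sub, Ideal.mem_span_singleton, dvd_neg]
    split_ifs
    · exact dvd_add (dvd_pow_self _ (by omega)) (dvd_mul_right _ _)
    · exact dvd_zero _
  · rw [hdeg]
    exact_mod_cast (by omega : 0 < m)
  · rw [hcoeff, if_neg (by omega), if_pos rfl, zero_sub, Ideal.span_singleton_pow,
      Ideal.mem_span_singleton, dvd_neg, hb]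
    intro h
    have h' : (X 0 : MvPolynomial (Fin 2) K) ^ 2 ∣ X 0 * X 1 ^ (q - 1) :=
      (dvd_add_right (pow_dvd_pow _ (by omega))).1 h
    rw [pow_two] at h'
    exact h01 (hp0.dvd_of_dvd_pow ((mul_dvd_mul_iff_left hp0.ne_zero).1 h'))
  · intro r hr
    rw [Polynomial.C_dvd_iff_dvd_coeff] at hr
    have hra : r ∣ a := by simpa [hcoeff, show m ≠ 0 by omega] using hr m
    have hrb : r ∣ b := by
      have := hr 0
      rw [hcoeff, if_neg (by omega), if_pos rfl, zero_sub, dvd_neg] at this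
      exact this
    obtain ⟨k, -, hk⟩ := (dvd_prime_pow hp1 _).1 hra
    rcases Nat.eq_zero_or_pos k with rfl | hk0
    · rw [pow_zero] at hk
      exact hk.symm.isUnit isUnit_one
    · exfalso
      have h1 : (X 1 : MvPolynomial (Fin 2) K) ∣ b :=
        (dvd_pow_self _ hk0.ne').trans (hk.symm.dvd.trans hrb)
      have h2 : (X 1 : MvPolynomial (Fin 2) K) ∣ X 0 * X 1 ^ (q - 1) :=
        (dvd_pow_self _ (by omega)).mul_left _
      exact h10 (hp1.dvd_of_dvd_pow ((dvd_add_left h2).1 h1))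

/-- The curve `𝓕_m`: the projective closure of the affine curve `y ^ m = x ^ q + x`, where
`2 ≤ m < q`. -/
def artinSchreierCurve (K : Type*) [Field K] (q m : ℕ) (hm : 2 ≤ m) (hmq : m < q) :
    PlaneCurve K where
  poly := artinSchreierPoly K q m
  isHomogeneous := by
    rw [(artinSchreierPoly_isHomogeneous K hmq).totalDegree
      (artinSchreierPoly_irreducible K hm hmq).ne_zero]
    exact artinSchreierPoly_isHomogeneous K hmq
  irreducible := artinSchreierPoly_irreducible K hm hmq

end GaloisPoints

end

/-! ### The function field of a plane curve, recognised from three functions -/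

noncomputable section

open MvPolynomial

namespace GaloisPoints

namespace PlaneCurve

variable {K : Type*} [Field K]

/-! Write `q + 1 = m * N`; since `m * N = 1` in `K`, neither factor is divisible by `p`. Suppose the
function field is `K(z, w)` with `w ^ m = T(z)` and `deg T ≤ m * N`, where `T` has a simple root and
no nontrivial `N`-th root of unity `ζ` satisfies `T(ζ Z) = T(Z)`. The plane model is the image of
`(w : z ^ N : 1)`. Its equation is the norm `∏ (W ^ m - T(ζ Z))` over the `N`-th roots of unity,
which is a polynomial in `Z ^ N` and becomes a form of degree `m * N = q + 1` (`normForm`). The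
factors are pairwise non-associated primes, so no relation between `w` and `z ^ N` has degree below
`m * N` in `w`. Division by the monic norm then shows that all relations are multiples of it; in
particular it is irreducible.

The projections from `(0 : 1 : 0)` and `(0 : 0 : 1)` are the functions `w` and `w / z ^ N`. Hence
both points are Galois as soon as `K(z, w)` is Galois over `K(w)` and over `K(w / z ^ N)`
(`exists_plane_model`). The first of these also gives birationality: an automorphism fixing `w` and
`z ^ N` sends `z` to `ζ z` with `T(ζ z) = T(z)`, so it is trivial (`adjoin_pow_eq_top`).

Inner points: take `z = x`, `w = y`, `T = X ^ q + X`. Over `K(y)` the element `x` is a root of an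
additive polynomial minus a constant. Dividing by `x ^ (q + 1)` gives `(y / x ^ N) ^ m = x⁻¹ ^ q +
x⁻¹`, so the other projection is of the same type. Both points lie on the curve because `T(0) = 0`
and `deg T = q < q + 1`, and they are smooth because the coefficients of `X` and `X ^ q` are
nonzero.

Outer points: take `T = (X - 1) ^ (q + 1) + (c - 1)` with `c ^ q = c` and `c ≠ 0, 1`. Over `K(w)`
this is a Kummer extension generated by `z - 1`. Since `c ^ q = c`, also `T(z) / z ^ (q + 1) = c *
(z⁻¹ - c⁻¹) ^ (q + 1) + (1 - c⁻¹)`, again of Kummer type. Both points are off the curve because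
`T(0) = c` and the leading coefficient `1` are nonzero. Moving a root of `T` to infinity turns `w ^
m = T(z)` into `y ^ m = x ^ q + x` (`exists_generators_shiftedFermat`).

What remains is the passage from functions to a morphism on the space of valuation rings: the
residue fields are `K`, each function has finitely many poles, and every point of the image curve is
dominated by a valuation ring (`exists_isMorphism_isBirationalOnto`). -/

theorem coord_eq_zero_iff (D : PlaneCurve K) (P : MvPolynomial (Fin 3) K) :
    D.coord P = 0 ↔ D.poly ∣ P := by
  have h : D.coord P = algebraMap D.CoordinateRing (FractionRing D.CoordinateRing)
      (Ideal.Quotient.mk (Ideal.span {D.poly}) P) := rfl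
  rw [h, FaithfulSMul.algebraMap_eq_zero_iff, Ideal.Quotient.eq_zero_iff_mem,
    Ideal.mem_span_singleton]

/-- The fraction `A / B` of two forms of the same degree as a rational function on `D`. -/
def fracForm (D : PlaneCurve K) {n : ℕ} {A B : MvPolynomial (Fin 3) K} (hA : A.IsHomogeneous n)
    (hB : B.IsHomogeneous n) (hB0 : D.coord B ≠ 0) : D.FunctionField :=
  ⟨D.coord A / D.coord B, n, A, B, hA, hB, hB0, rfl⟩

/-- A field generated by the quotients of three elements, whose homogeneous relations are
the multiples of the equation of `D`, is the function field of `D`. -/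
theorem exists_algEquiv_functionField (D : PlaneCurve K) {F : Type*} [Field F] [Algebra K F]
    (f : Fin 3 → F)
    (hker : ∀ (n : ℕ) (P : MvPolynomial (Fin 3) K), P.IsHomogeneous n →
      (aeval f P = 0 ↔ D.poly ∣ P))
    (hgen : IntermediateField.adjoin K {g | ∃ i j, g = f i / f j} = ⊤) :
    ∃ σ : D.FunctionField ≃ₐ[K] F, ∀ (g : D.FunctionField) (n : ℕ)
      (A B : MvPolynomial (Fin 3) K), A.IsHomogeneous n → B.IsHomogeneous n → D.coord B ≠ 0 →
      (g : FractionRing D.CoordinateRing) = D.coord A / D.coord B →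
      σ g = aeval f A / aeval f B := by
  have hne : ∀ (n : ℕ) (P : MvPolynomial (Fin 3) K), P.IsHomogeneous n →
      D.coord P ≠ 0 → aeval f P ≠ 0 := by
    intro n P hP h h'
    exact h ((D.coord_eq_zero_iff P).2 ((hker n P hP).1 h'))
  -- The value does not depend on the chosen fraction: the cross-multiplied difference is a form of
  -- degree `n + n'`, so `hker` applies to it.
  have hwd : ∀ (n n' : ℕ) (A B A' B' : MvPolynomial (Fin 3) K), A.IsHomogeneous n →
      B.IsHomogeneous n → D.coord B ≠ 0 → A'.IsHomogeneous n' → B'.IsHomogeneous n' →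
      D.coord B' ≠ 0 → D.coord A / D.coord B = D.coord A' / D.coord B' →
      aeval f A / aeval f B = aeval f A' / aeval f B' := by
    intro n n' A B A' B' hA hB hB0 hA' hB' hB0' h
    rw [div_eq_div_iff hB0 hB0', ← map_mul, ← map_mul, ← sub_eq_zero, ← map_sub,
      coord_eq_zero_iff, ← hker (n + n')] at h
    · rw [div_eq_div_iff (hne _ _ hB hB0) (hne _ _ hB' hB0'), ← map_mul, ← map_mul, ← sub_eq_zero,
        ← map_sub, h]
    · have := hA'.mul hB
      rw [add_comm] at this
      exact (hA.mul hB').sub this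
  choose n A B hA hB hB0 hg using fun g : D.FunctionField => g.2
  have key : ∀ (g : D.FunctionField) (n' : ℕ) (A' B' : MvPolynomial (Fin 3) K),
      A'.IsHomogeneous n' → B'.IsHomogeneous n' → D.coord B' ≠ 0 →
      (g : FractionRing D.CoordinateRing) = D.coord A' / D.coord B' →
      aeval f (A g) / aeval f (B g) = aeval f A' / aeval f B' := by
    intro g n' A' B' hA' hB' hB0' h
    exact hwd _ _ _ _ _ _ (hA g) (hB g) (hB0 g) hA' hB' hB0' ((hg g).symm.trans h)
  have hC : ∀ c : K, aeval f (A (algebraMap K D.FunctionField c)) /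
      aeval f (B (algebraMap K D.FunctionField c)) = algebraMap K F c := by
    intro c
    rw [key _ 0 (C c) 1 (isHomogeneous_C _ _) (isHomogeneous_one _ _) (by simp)
      (by rw [map_one, div_one]; exact (D.coord.commutes c).symm)]
    simp
  let φ : D.FunctionField →ₐ[K] F :=
    { toFun := fun g => aeval f (A g) / aeval f (B g)
      map_one' := by simpa using hC 1
      map_zero' := by simpa using hC 0
      map_mul' := by
        intro g g'
        rw [key (g * g') (n g + n g') (A g * A g') (B g * B g') ((hA g).mul (hA g'))
          ((hB g).mul (hB g')) (by rw [map_mul]; exact mul_ne_zero (hB0 g) (hB0 g'))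
          (by rw [map_mul, map_mul, ← div_mul_div_comm, ← hg, ← hg]; rfl)]
        rw [map_mul, map_mul, div_mul_div_comm]
      map_add' := by
        intro g g'
        rw [key (g + g') (n g + n g') (A g * B g' + B g * A g') (B g * B g')
          (((hA g).mul (hB g')).add ((hB g).mul (hA g')))
          ((hB g).mul (hB g')) (by rw [map_mul]; exact mul_ne_zero (hB0 g) (hB0 g'))
          (by
            rw [map_mul, map_add, map_mul, map_mul, ← div_add_div _ _ (hB0 g) (hB0 g'),
              ← hg, ← hg]; rfl)]
        rw [map_mul, map_add, map_mul, map_mul,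
          ← div_add_div _ _ (hne _ _ (hB g) (hB0 g)) (hne _ _ (hB g') (hB0 g'))]
      commutes' := hC }
  have hφ : ∀ (g : D.FunctionField) (n' : ℕ) (A' B' : MvPolynomial (Fin 3) K),
      A'.IsHomogeneous n' → B'.IsHomogeneous n' → D.coord B' ≠ 0 →
      (g : FractionRing D.CoordinateRing) = D.coord A' / D.coord B' →
      φ g = aeval f A' / aeval f B' := key
  have hsurj : Function.Surjective φ := by
    rw [← AlgHom.fieldRange_eq_top, ← top_le_iff, ← hgen, IntermediateField.adjoin_le_iff]
    rintro _ ⟨i, j, rfl⟩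
    -- If the denominator vanishes on `D`, then `f j = 0` and the quotient has the default value
    -- `0`.
    by_cases hj : D.coord (X j) = 0
    · have : aeval f (X j : MvPolynomial (Fin 3) K) = 0 :=
        (hker 1 _ (isHomogeneous_X _ _)).2 ((D.coord_eq_zero_iff _).1 hj)
      rw [aeval_X] at this
      rw [this, div_zero]
      exact zero_mem _
    · refine ⟨D.fracForm (isHomogeneous_X _ i) (isHomogeneous_X _ j) hj, ?_⟩
      change φ _ = _
      rw [hφ _ 1 (X i) (X j) (isHomogeneous_X _ _) (isHomogeneous_X _ _) hj rfl]
      simp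
  exact ⟨AlgEquiv.ofBijective φ ⟨φ.injective, hsurj⟩, hφ⟩

end PlaneCurve

end GaloisPoints

end

/-! ### Valuation rings of a function field: residue fields and poles -/

noncomputable section

open MvPolynomial

namespace GaloisPoints

section Valuation

variable {K F : Type*} [Field K] [Field F] [Algebra K F]

open IntermediateField
open scoped algebraAdjoinAdjoin

theorem mem_valuationSubring_of_isIntegral {A : Type*} [CommRing A] [Algebra A F]
    {R : ValuationSubring F} (hA : ∀ a, algebraMap A F a ∈ R) {g : F} (hg : IsIntegral A g) :
    g ∈ R := by
  let ι : A →+* R := (algebraMap A F).codRestrict R.toSubring hA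
  obtain ⟨p, hp, hpg⟩ := hg
  have : IsIntegral R g := by
    refine ⟨p.map ι, hp.map _, ?_⟩
    rw [Polynomial.eval₂_map]
    exact hpg
  obtain ⟨r, hr⟩ := IsIntegrallyClosed.isIntegral_iff.1 this
  rw [← hr]
  exact r.2

/-- The transcendence degree is at most one, so a single transcendental element is already a
transcendence basis. -/
theorem isAlgebraic_adjoin_simple_of_transcendental {x g : F} [FiniteDimensional K⟮x⟯ F]
    (hg : Transcendental K g) : Algebra.IsAlgebraic K⟮g⟯ F := by
  have hx : Algebra.IsAlgebraic (Algebra.adjoin K {x}) F :=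
    (IsFractionRing.comap_isAlgebraic_iff (K := K⟮x⟯)).2 inferInstance
  have hle : Algebra.trdeg K F ≤ 1 := by
    simpa using Algebra.IsAlgebraic.trdeg_le_cardinalMk K ({x} : Set F)
  have hind : AlgebraicIndependent K (fun _ : Unit => g) :=
    (algebraicIndependent_singleton_iff ()).2 hg
  have := (hind.isTranscendenceBasis_of_lift_trdeg_le_of_finite (by simpa using hle)).isAlgebraic_field
  rwa [Set.range_const] at this

/-- The residue fields of a function field in one variable over an algebraically closed field
are the field of constants. -/
theorem exists_valuation_sub_algebraMap_lt_one [IsAlgClosed K]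
    (htr : ∀ g : F, Transcendental K g → Algebra.IsAlgebraic K⟮g⟯ F) {R : ValuationSubring F}
    (hK : ∀ c : K, algebraMap K F c ∈ R) (hR : R ≠ ⊤) {g : F} (hg : g ∈ R) :
    ∃ c : K, R.valuation (g - algebraMap K F c) < 1 := by
  by_contra! hlt
  have h1 : ∀ c, R.valuation (g - algebraMap K F c) = 1 := fun c =>
    le_antisymm ((R.valuation_le_one_iff _).2 (R.toSubring.sub_mem hg (hK c))) (hlt c)
  have hK1 : ∀ c : K, c ≠ 0 → R.valuation (algebraMap K F c) = 1 := by
    intro c hc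
    refine le_antisymm ((R.valuation_le_one_iff _).2 (hK c)) ?_
    have h := (R.valuation_le_one_iff _).2 (hK c⁻¹)
    rw [map_inv₀, map_inv₀] at h
    have h0 : R.valuation (algebraMap K F c) ≠ 0 := by simpa using hc
    exact (inv_le_one₀ (zero_lt_iff.2 h0)).1 h
  -- If no `g - c` lies in the maximal ideal, all of them are units; as `p` splits into linear
  -- factors, `p(g)` is a unit too. Then `g` is transcendental and `K(g)` lies in `R`. Since `F` is
  -- algebraic over `K(g)` and `R` is integrally closed, `R = F`.
  have hp : ∀ p : Polynomial K, p ≠ 0 → R.valuation (Polynomial.aeval g p) = 1 := by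
    intro p hp
    rw [(IsAlgClosed.splits p).eq_prod_roots, map_mul, map_mul, Polynomial.aeval_C,
      hK1 _ (Polynomial.leadingCoeff_ne_zero.2 hp), one_mul, map_multiset_prod, map_multiset_prod]
    refine Multiset.prod_eq_one ?_
    simp only [Multiset.map_map, Multiset.mem_map, Function.comp]
    rintro _ ⟨a, -, rfl⟩
    simpa using h1 a
  have hgt : Transcendental K g := by
    rintro ⟨p, hp0, hpg⟩
    have := hp p hp0
    rw [hpg, map_zero] at this
    exact zero_ne_one this
  have hmem : ∀ a : K⟮g⟯, algebraMap K⟮g⟯ F a ∈ R := by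
    rintro ⟨a, ha⟩
    obtain ⟨r, s, rfl⟩ := (mem_adjoin_simple_iff K _).1 ha
    by_cases hr : r = 0
    · simp [hr]
    by_cases hs : s = 0
    · simp [hs]
    rw [← R.valuation_le_one_iff]
    change R.valuation (_ / _) ≤ 1
    rw [map_div₀, hp r hr, hp s hs, div_one]
  have := htr g hgt
  refine hR (top_le_iff.1 fun f _ => ?_)
  exact mem_valuationSubring_of_isIntegral hmem (Algebra.IsIntegral.isIntegral (R := K⟮g⟯) f)

/-- Only finitely many valuation rings containing `h` are poles of `g`. -/
theorem finite_setOf_notMem_valuationSubring (h : F) [FiniteDimensional K⟮h⟯ F]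
    [Algebra.IsSeparable K⟮h⟯ F] (g : F) :
    {R : ValuationSubring F | (∀ c : K, algebraMap K F c ∈ R) ∧ R ≠ ⊤ ∧ h ∈ R ∧ g ∉ R}.Finite := by
  let A₀ := Algebra.adjoin K {h}
  have : IsPrincipalIdealRing A₀ := by
    have e := Algebra.adjoin_singleton_eq_range_aeval K h
    have : IsPrincipalIdealRing (Polynomial.aeval h : Polynomial K →ₐ[K] F).range :=
      IsPrincipalIdealRing.of_surjective (Polynomial.aeval h : Polynomial K →ₐ[K] F).rangeRestrict
        (AlgHom.rangeRestrict_surjective _)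
    change IsPrincipalIdealRing (Algebra.adjoin K {h})
    rw [e]
    exact this
  -- A valuation ring containing `K` and `h` contains this Dedekind domain and is its localization
  -- at the trace `P` of the maximal ideal. If `g = a / b` is not in the ring, then `P` divides the
  -- ideal `(b)`, which leaves finitely many choices.
  let A := integralClosure A₀ F
  have : IsDedekindDomain A := integralClosure.isDedekindDomain A₀ K⟮h⟯ F
  have : IsFractionRing A F :=
    integralClosure.isFractionRing_of_finite_extension (A := A₀) K⟮h⟯ F
  obtain ⟨a, b, hb, hab⟩ := IsFractionRing.div_surjective (A := A) g
  have hb0 : b ≠ 0 := nonZeroDivisors.ne_zero hb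
  have hfin := Ideal.finite_factors (I := Ideal.span {b}) (by simpa using hb0)
  refine (hfin.image fun v => v.valuationSubringAtPrime F).subset ?_
  rintro R ⟨hK, hR, hh, hg⟩
  have hA₀ : ∀ r : A₀, algebraMap A₀ F r ∈ R := by
    rintro ⟨r, hr⟩
    change r ∈ R
    refine Algebra.adjoin_induction (p := fun r _ => r ∈ R) ?_ hK
      (fun _ _ _ _ => R.add_mem _ _) (fun _ _ _ _ => R.mul_mem _ _) hr
    rintro _ rfl
    exact hh
  have hA : ∀ r : A, algebraMap A F r ∈ R := fun r => mem_valuationSubring_of_isIntegral hA₀ r.2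
  let ι : A →+* R := (algebraMap A F).codRestrict R.toSubring hA
  let P : Ideal A := (IsLocalRing.maximalIdeal R).comap ι
  have hP : ∀ r : A, r ∈ P ↔ R.valuation (algebraMap A F r) < 1 := fun r =>
    R.valuation_lt_one_iff (ι r)
  have hPc : ∀ r : A, r ∉ P → (algebraMap A F r)⁻¹ ∈ R := by
    intro r hr
    rw [hP, not_lt] at hr
    rw [← R.valuation_le_one_iff, map_inv₀]
    exact inv_le_one_of_one_le₀ hr
  have hbP : b ∈ P := by
    by_contra hb'
    refine hg ?_
    rw [← hab, div_eq_mul_inv]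
    exact R.mul_mem _ _ (hA a) (hPc b hb')
  have hP0 : P ≠ ⊥ := fun h0 => hb0 (by rw [h0] at hbP; exact hbP)
  let v : IsDedekindDomain.HeightOneSpectrum A := ⟨P, Ideal.IsPrime.comap ι, hP0⟩
  refine ⟨v, ?_, ?_⟩
  · exact Ideal.dvd_iff_le.2 ((Ideal.span_singleton_le_iff_mem _).2 hbP)
  -- The localization at a nonzero prime of a Dedekind domain is a maximal proper subring, so it
  -- suffices that `R` contains it.
  · refine ValuationSubring.eq_of_le_of_ne_top _ ?_ hR
    rintro x ⟨r, s, hs, rfl⟩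
    exact R.mul_mem _ _ (hA r) (hPc s hs)

/-- A rational function has finitely many poles. -/
theorem finite_setOf_notMem_valuationSubring_of_simple (x : F) [FiniteDimensional K⟮x⟯ F]
    [Algebra.IsSeparable K⟮x⟯ F] (g : F) :
    {R : ValuationSubring F | (∀ c : K, algebraMap K F c ∈ R) ∧ R ≠ ⊤ ∧ g ∉ R}.Finite := by
  -- Every valuation ring contains `x` or `x⁻¹`; these two affine charts cover all of them.
  have hx : K⟮x⁻¹⟯ = K⟮x⟯ := by
    refine le_antisymm ?_ ?_ <;> rw [adjoin_simple_le_iff]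
    · exact inv_mem (mem_adjoin_simple_self K x)
    · simpa using inv_mem (mem_adjoin_simple_self K x⁻¹)
  have : FiniteDimensional K⟮x⁻¹⟯ F := by rw [hx]; infer_instance
  have : Algebra.IsSeparable K⟮x⁻¹⟯ F := by rw [hx]; infer_instance
  refine ((finite_setOf_notMem_valuationSubring (K := K) x g).union
    (finite_setOf_notMem_valuationSubring (K := K) x⁻¹ g)).subset ?_
  rintro R ⟨hK, hR, hg⟩
  rcases R.mem_or_inv_mem x with h | h
  · exact Or.inl ⟨hK, hR, h, hg⟩
  · exact Or.inr ⟨hK, hR, h, hg⟩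

end Valuation

end GaloisPoints

end

/-! ### Morphisms from the smooth model to the plane -/

noncomputable section

open MvPolynomial

namespace GaloisPoints

/-- A form of degree `n` is homogeneous of degree `n` as a function. -/
theorem aeval_mul_left_of_isHomogeneous {K A ι : Type*} [CommRing K] [CommRing A] [Algebra K A]
    {n : ℕ} {P : MvPolynomial ι K} (hP : P.IsHomogeneous n) (a : A) (g : ι → A) :
    aeval (fun i => a * g i) P = a ^ n * aeval g P := by
  simp only [aeval_def, eval₂_eq, Finset.mul_sum]
  refine Finset.sum_congr rfl fun d hd => ?_
  have hdeg := hP.degree_eq_sum_deg_support hd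
  simp only [mul_pow, Finset.prod_mul_distrib, Finset.prod_pow_eq_pow_sum]
  rw [← hdeg]
  ring

namespace PlaneCurve

variable {K : Type*} [Field K]

theorem eval_mul_left_of_isHomogeneous {n : ℕ} {P : MvPolynomial (Fin 3) K}
    (hP : P.IsHomogeneous n) (a : K) (c : Fin 3 → K) :
    eval (fun i => a * c i) P = a ^ n * eval c P := by
  have := aeval_mul_left_of_isHomogeneous hP a c
  simpa only [aeval_eq_eval] using this

theorem exists_rep_mk (c : Fin 3 → K) (hc : c ≠ 0) :
    ∃ a : K, a ≠ 0 ∧ ∀ (n : ℕ) (P : MvPolynomial (Fin 3) K), P.IsHomogeneous n →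
      eval (Projectivization.mk K c hc).rep P = a ^ n * eval c P := by
  obtain ⟨a, ha⟩ := Projectivization.exists_smul_eq_mk_rep K c hc
  refine ⟨a, a.ne_zero, fun n P hP => ?_⟩
  rw [← eval_mul_left_of_isHomogeneous hP, ← ha]
  rfl

namespace SmoothModel

variable {C : PlaneCurve K} {R : C.SmoothModel}

theorem hasValueAt_algebraMap (R : C.SmoothModel) (c : K) :
    HasValueAt (algebraMap K C.FunctionField c) R c := by
  simp [HasValueAt]

theorem valuation_algebraMap_le_one (R : C.SmoothModel) (c : K) :
    R.1.valuation (algebraMap K C.FunctionField c) ≤ 1 :=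
  (R.1.valuation_le_one_iff _).2 (R.2.1 c)

theorem HasValueAt.mem {f : C.FunctionField} {a : K} (h : HasValueAt f R a) : f ∈ R.1 := by
  have h1 := (R.1.valuation_le_one_iff _).1 (le_of_lt h)
  simpa using R.1.add_mem _ _ h1 (R.2.1 a)

theorem HasValueAt.add {f g : C.FunctionField} {a b : K} (hf : HasValueAt f R a)
    (hg : HasValueAt g R b) : HasValueAt (f + g) R (a + b) := by
  unfold HasValueAt at *
  rw [map_add, add_sub_add_comm]
  exact Valuation.map_add_lt _ hf hg

theorem HasValueAt.mul {f g : C.FunctionField} {a b : K} (hf : HasValueAt f R a)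
    (hg : HasValueAt g R b) : HasValueAt (f * g) R (a * b) := by
  have hf' := hf.mem
  unfold HasValueAt at *
  rw [map_mul, show f * g - algebraMap K C.FunctionField a * algebraMap K C.FunctionField b
    = f * (g - algebraMap K C.FunctionField b)
      + algebraMap K C.FunctionField b * (f - algebraMap K C.FunctionField a) by ring]
  refine Valuation.map_add_lt _ ?_ ?_
  · rw [map_mul]
    exact mul_lt_one_of_nonneg_of_lt_one_right ((R.1.valuation_le_one_iff _).2 hf') zero_le hg
  · rw [map_mul]
    exact mul_lt_one_of_nonneg_of_lt_one_right (valuation_algebraMap_le_one R b) zero_le hf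

theorem HasValueAt.unique {f : C.FunctionField} {a b : K} (ha : HasValueAt f R a)
    (hb : HasValueAt f R b) : a = b := by
  by_contra hab
  unfold HasValueAt at *
  have h : R.1.valuation (algebraMap K C.FunctionField (a - b)) < 1 := by
    rw [map_sub, show algebraMap K C.FunctionField a - algebraMap K C.FunctionField b
      = (f - algebraMap K C.FunctionField b) - (f - algebraMap K C.FunctionField a) by ring]
    exact (Valuation.map_sub _ _ _).trans_lt (max_lt hb ha)
  have h1 : R.1.valuation (algebraMap K C.FunctionField ((a - b) * (a - b)⁻¹)) < 1 := by
    rw [map_mul, map_mul]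
    exact mul_lt_one_of_nonneg_of_lt_one_left zero_le h (valuation_algebraMap_le_one R _)
  rw [mul_inv_cancel₀ (sub_ne_zero.2 hab), map_one, map_one] at h1
  exact lt_irrefl _ h1

theorem HasValueAt.inv {f : C.FunctionField} {a : K} (hf : HasValueAt f R a) (ha : a ≠ 0) :
    HasValueAt f⁻¹ R a⁻¹ := by
  have hmem := hf.mem
  have hv : R.1.valuation f = 1 := by
    refine le_antisymm ((R.1.valuation_le_one_iff _).2 hmem) ?_
    by_contra! hlt
    have h0 : HasValueAt f R 0 := by simpa [HasValueAt] using hlt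
    exact ha (hf.unique h0)
  have hf0 : f ≠ 0 := by
    rintro rfl
    simp at hv
  unfold HasValueAt at *
  rw [map_inv₀, show f⁻¹ - (algebraMap K C.FunctionField a)⁻¹
      = -(f⁻¹ * algebraMap K C.FunctionField a⁻¹) * (f - algebraMap K C.FunctionField a) by
    rw [map_inv₀]
    have : algebraMap K C.FunctionField a ≠ 0 := by simpa using ha
    field_simp
    ring]
  rw [map_mul, Valuation.map_neg, map_mul, map_inv₀, hv, inv_one, one_mul]
  exact mul_lt_one_of_nonneg_of_lt_one_right (valuation_algebraMap_le_one R _) zero_le hf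

theorem HasValueAt.aeval {g : Fin 3 → C.FunctionField} {c : Fin 3 → K}
    (h : ∀ i, HasValueAt (g i) R (c i)) (P : MvPolynomial (Fin 3) K) :
    HasValueAt (aeval g P) R (eval c P) := by
  induction P using MvPolynomial.induction_on with
  | C a => simpa using hasValueAt_algebraMap R a
  | add P Q hP hQ => simpa using hP.add hQ
  | mul_X P i hP => simpa using hP.mul (h i)

end SmoothModel

/-- Every point of the curve with equation `D.poly` is dominated by a valuation ring of a field
whose elements satisfy the relation `D.poly`. -/
theorem exists_valuationSubring_of_mem_points (D : PlaneCurve K) {F : Type*} [Field F]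
    [Algebra K F] (f : Fin 3 → F)
    (hker : ∀ (n : ℕ) (P : MvPolynomial (Fin 3) K), P.IsHomogeneous n →
      (aeval f P = 0 ↔ D.poly ∣ P)) {Q : Plane K} (hQ : Q ∈ D.points) :
    ∃ R : ValuationSubring F, ∀ (n : ℕ) (A B : MvPolynomial (Fin 3) K), A.IsHomogeneous n →
      B.IsHomogeneous n → eval Q.rep B ≠ 0 → aeval f A / aeval f B ∈ R ∧
      (eval Q.rep A = 0 → R.valuation (aeval f A / aeval f B) < 1) := by
  have hdvd : ∀ P, D.poly ∣ P → eval Q.rep P = 0 := by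
    rintro _ ⟨P, rfl⟩
    rw [map_mul, show eval Q.rep D.poly = 0 from hQ, zero_mul]
  have hne : ∀ (n : ℕ) (B : MvPolynomial (Fin 3) K), B.IsHomogeneous n →
      eval Q.rep B ≠ 0 → aeval f B ≠ 0 := fun n B hB h h' => h (hdvd _ ((hker n B hB).1 h'))
  -- The local ring of `D` at `Q`, transported into `F`; the ideal `I` below consists of the
  -- functions vanishing at `Q`.
  let O : Subring F :=
    { carrier := {s | ∃ (n : ℕ) (A B : MvPolynomial (Fin 3) K), A.IsHomogeneous n ∧
        B.IsHomogeneous n ∧ eval Q.rep B ≠ 0 ∧ s = aeval f A / aeval f B}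
      one_mem' := ⟨0, 1, 1, isHomogeneous_one _ _, isHomogeneous_one _ _, by simp, by simp⟩
      zero_mem' := ⟨0, 0, 1, isHomogeneous_zero _ _ _, isHomogeneous_one _ _, by simp, by simp⟩
      neg_mem' := by
        rintro _ ⟨n, A, B, hA, hB, hB0, rfl⟩
        exact ⟨n, -A, B, hA.neg, hB, hB0, by rw [map_neg, neg_div]⟩
      mul_mem' := by
        rintro _ _ ⟨n, A, B, hA, hB, hB0, rfl⟩ ⟨n', A', B', hA', hB', hB0', rfl⟩
        exact ⟨n + n', A * A', B * B', hA.mul hA', hB.mul hB',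
          by rw [map_mul]; exact mul_ne_zero hB0 hB0', by rw [map_mul, map_mul, div_mul_div_comm]⟩
      add_mem' := by
        rintro _ _ ⟨n, A, B, hA, hB, hB0, rfl⟩ ⟨n', A', B', hA', hB', hB0', rfl⟩
        exact ⟨n + n', A * B' + B * A', B * B', (hA.mul hB').add (hB.mul hA'), hB.mul hB',
          by rw [map_mul]; exact mul_ne_zero hB0 hB0', by
            rw [map_add, map_mul, map_mul, map_mul,
              div_add_div _ _ (hne _ _ hB hB0) (hne _ _ hB' hB0')]⟩ }
  let I : Ideal O :=
    { carrier := {s | ∃ (n : ℕ) (A B : MvPolynomial (Fin 3) K), A.IsHomogeneous n ∧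
        B.IsHomogeneous n ∧ eval Q.rep B ≠ 0 ∧ eval Q.rep A = 0 ∧
        (s : F) = aeval f A / aeval f B}
      zero_mem' := ⟨0, 0, 1, isHomogeneous_zero _ _ _, isHomogeneous_one _ _, by simp, by simp,
        by simp⟩
      smul_mem' := by
        rintro ⟨_, n, A, B, hA, hB, hB0, rfl⟩ _ ⟨n', A', B', hA', hB', hB0', hA0', h⟩
        refine ⟨n + n', A * A', B * B', hA.mul hA', hB.mul hB',
          by rw [map_mul]; exact mul_ne_zero hB0 hB0', by rw [map_mul, hA0', mul_zero], ?_⟩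
        rw [map_mul, map_mul, ← div_mul_div_comm, ← h]
        rfl
      add_mem' := by
        rintro _ _ ⟨n, A, B, hA, hB, hB0, hA0, h⟩ ⟨n', A', B', hA', hB', hB0', hA0', h'⟩
        refine ⟨n + n', A * B' + B * A', B * B', (hA.mul hB').add (hB.mul hA'), hB.mul hB',
          by rw [map_mul]; exact mul_ne_zero hB0 hB0', by simp [hA0, hA0'], ?_⟩
        rw [map_add, map_mul, map_mul, map_mul,
              ← div_add_div _ _ (hne _ _ hB hB0) (hne _ _ hB' hB0'), ← h, ← h']
        rfl }
  have hI : I ≠ ⊤ := by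
    rw [Ideal.ne_top_iff_one]
    rintro ⟨n, A, B, hA, hB, hB0, hA0, h⟩
    rw [eq_div_iff (hne _ _ hB hB0), OneMemClass.coe_one, one_mul, ← sub_eq_zero, ← map_sub,
      hker n _ (hB.sub hA)] at h
    have := hdvd _ h
    rw [map_sub, hA0, sub_zero] at this
    exact hB0 this
  -- Chevalley's extension theorem: a proper ideal of a subring lies in the nonunits of some
  -- valuation ring containing the subring.
  obtain ⟨R, hOR, hIR⟩ := Ideal.image_subset_nonunits_valuationSubring I hI
  refine ⟨R, fun n A B hA hB hB0 => ⟨hOR ⟨n, A, B, hA, hB, hB0, rfl⟩, fun hA0 => ?_⟩⟩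
  rw [← ValuationSubring.mem_nonunits_iff]
  exact hIR ⟨⟨_, n, A, B, hA, hB, hB0, rfl⟩, ⟨n, A, B, hA, hB, hB0, hA0, rfl⟩, rfl⟩

/-- Three functions on `C` that generate the function field and whose homogeneous relations are
the multiples of the equation of `D` define a morphism from the smooth model of `C` that is
birational onto `D`. -/
theorem exists_isMorphism_isBirationalOnto {C D : PlaneCurve K}
    (hres : ∀ (R : C.SmoothModel) (g : C.FunctionField), g ∈ R.1 →
      ∃ c, SmoothModel.HasValueAt g R c)
    (hfin : ∀ g : C.FunctionField, {R : C.SmoothModel | g ∉ R.1}.Finite)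
    (f : Fin 3 → C.FunctionField) (hf0 : ∀ i, f i ≠ 0)
    (hnc : ∃ i j, ∀ c : K, f i ≠ algebraMap K C.FunctionField c * f j)
    (hker : ∀ (n : ℕ) (P : MvPolynomial (Fin 3) K), P.IsHomogeneous n →
      (aeval f P = 0 ↔ D.poly ∣ P))
    (σ : D.FunctionField ≃ₐ[K] C.FunctionField)
    (hσ : ∀ (g : D.FunctionField) (n : ℕ)
      (A B : MvPolynomial (Fin 3) K), A.IsHomogeneous n → B.IsHomogeneous n → D.coord B ≠ 0 →
      (g : FractionRing D.CoordinateRing) = D.coord A / D.coord B →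
      σ g = aeval f A / aeval f B) :
    ∃ φ : C.SmoothModel → Plane K, SmoothModel.IsMorphism φ ∧
      SmoothModel.IsBirationalOnto φ D := by
  -- Dividing by a coordinate of largest valuation makes all coordinates regular, and the `j`-th one
  -- equal to `1`.
  have hmax : ∀ R : C.SmoothModel, ∃ j, ∀ i, f i / f j ∈ R.1 := by
    intro R
    obtain ⟨j, hj⟩ := Finite.exists_max fun i => R.1.valuation (f i)
    refine ⟨j, fun i => ?_⟩
    rw [← R.1.valuation_le_one_iff, map_div₀]
    exact div_le_one_of_le₀ (hj i) zero_le
  choose j hj using hmax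
  choose c hc using fun (R : C.SmoothModel) (i : Fin 3) => hres R _ (hj R i)
  have hcj : ∀ (R : C.SmoothModel) (l : Fin 3) (b : Fin 3 → K),
      (∀ i, SmoothModel.HasValueAt (f i / f l) R (b i)) → b l = 1 := by
    intro R l b hb
    have h := hb l
    rw [div_self (hf0 l)] at h
    have h1 := SmoothModel.hasValueAt_algebraMap R 1
    rw [map_one] at h1
    exact h.unique h1
  have hc0 : ∀ R, c R ≠ 0 := fun R h0 => by
    have := hcj R (j R) (c R) (hc R)
    rw [h0] at this
    exact zero_ne_one this
  let φ : C.SmoothModel → Plane K := fun R => Projectivization.mk K (c R) (hc0 R)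
  -- The point may be computed with any denominator `f l` that leaves the quotients regular. This
  -- allows one denominator on a whole neighbourhood.
  have hφ : ∀ (R : C.SmoothModel) (l : Fin 3) (b : Fin 3 → K) (hb0 : b ≠ 0),
      (∀ i, SmoothModel.HasValueAt (f i / f l) R (b i)) → φ R = Projectivization.mk K b hb0 := by
    intro R l b hb0 hb
    rw [Projectivization.mk_eq_mk_iff']
    refine ⟨c R l, funext fun i => ?_⟩
    have h := (hc R l).mul (hb i)
    rw [div_mul_div_comm, mul_comm (f l), mul_div_mul_right _ _ (hf0 l)] at h
    exact h.unique (hc R i)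
  have haev : ∀ (l : Fin 3) (n : ℕ) (P : MvPolynomial (Fin 3) K), P.IsHomogeneous n →
      aeval f P = f l ^ n * aeval (fun i => f i / f l) P := by
    intro l n P hP
    rw [← aeval_mul_left_of_isHomogeneous hP]
    congr 2
    funext i
    rw [mul_div_cancel₀ _ (hf0 l)]
  have hpt : ∀ R, φ R ∈ D.points := by
    intro R
    obtain ⟨a, -, ha⟩ := exists_rep_mk (c R) (hc0 R)
    change eval (φ R).rep D.poly = 0
    rw [ha _ _ D.isHomogeneous]
    have h := SmoothModel.HasValueAt.aeval (hc R) D.poly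
    have h0 := (hker _ _ D.isHomogeneous).2 dvd_rfl
    rw [haev (j R) _ _ D.isHomogeneous] at h0
    rw [(mul_eq_zero.1 h0).resolve_left (pow_ne_zero _ (hf0 _))] at h
    have h1 := SmoothModel.hasValueAt_algebraMap R 0
    rw [map_zero] at h1
    rw [h.unique h1, mul_zero]
  refine ⟨φ, ?_, ?_, σ, ?_⟩
  · intro R₀
    refine ⟨{R | ∀ i, f i / f (j R₀) ∈ R.1}, hj R₀, ?_, fun i => f i / f (j R₀), ?_⟩
    · refine (Set.finite_iUnion fun i => hfin (f i / f (j R₀))).subset ?_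
      intro R hR
      simpa using hR
    · intro R hR
      choose b hb using fun i => hres R _ (hR i)
      have hb0 : b ≠ 0 := fun h0 => by
        have := hcj R _ b hb
        rw [h0] at this
        exact zero_ne_one this
      exact ⟨b, hb0, hb, hφ R _ b hb0 hb⟩
  · refine Set.Subset.antisymm (Set.range_subset_iff.2 hpt) fun Q hQ => ?_
    obtain ⟨R, hR⟩ := D.exists_valuationSubring_of_mem_points f hker hQ
    obtain ⟨l, hl⟩ := Function.ne_iff.1 Q.rep_nonzero
    have hl' : eval Q.rep (X l) ≠ 0 := by simpa using hl
    have hK : ∀ a : K, algebraMap K C.FunctionField a ∈ R := by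
      intro a
      simpa using (hR 0 (MvPolynomial.C a) 1 (isHomogeneous_C _ _) (isHomogeneous_one _ _)
        (by simp)).1
    have hval : ∀ i, R.valuation (f i / f l
        - algebraMap K C.FunctionField (Q.rep i / Q.rep l)) < 1 := by
      intro i
      have := (hR 1 (X i - MvPolynomial.C (Q.rep i / Q.rep l) * X l) (X l)
        ((isHomogeneous_X _ _).sub (isHomogeneous_C_mul_X _ _)) (isHomogeneous_X _ _) hl').2 (by
          have : Q.rep l ≠ 0 := hl
          simp [this])
      rw [map_sub, map_mul, aeval_X, aeval_X, aeval_C, sub_div, mul_div_cancel_right₀ _ (hf0 l)]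
        at this
      exact this
    -- In the trivial valuation ring only `0` is a nonunit, so all `f i` would be constant multiples
    -- of `f l`, against `hnc`.
    have htop : R ≠ ⊤ := by
      rintro rfl
      have hz : ∀ i, f i = algebraMap K C.FunctionField (Q.rep i / Q.rep l) * f l := by
        intro i
        have h := (ValuationSubring.mem_nonunits_iff _).2 (hval i)
        rw [ValuationSubring.mem_nonunits_iff_or] at h
        have h := h.resolve_right fun h => h (ValuationSubring.mem_top _)
        rw [← sub_eq_zero.1 h, div_mul_cancel₀ _ (hf0 l)]
      obtain ⟨i, k, hik⟩ := hnc
      refine hik ((Q.rep i / Q.rep l) / (Q.rep k / Q.rep l)) ?_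
      have hk : algebraMap K C.FunctionField (Q.rep k / Q.rep l) ≠ 0 := by
        intro h
        have := hz k
        rw [h, zero_mul] at this
        exact hf0 k this
      rw [hz i, hz k, map_div₀ _ (Q.rep i / Q.rep l), ← mul_assoc, div_mul_cancel₀ _ hk]
    refine ⟨⟨R, hK, htop⟩, ?_⟩
    have hb0 : (fun i => Q.rep i / Q.rep l) ≠ 0 := fun h0 => by
      have := congrFun h0 l
      simp only [Pi.zero_apply, div_self (show Q.rep l ≠ 0 from hl)] at this
      exact one_ne_zero this
    rw [hφ ⟨R, hK, htop⟩ l (fun i => Q.rep i / Q.rep l) hb0 hval]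
    conv_rhs => rw [← Q.mk_rep]
    rw [Projectivization.mk_eq_mk_iff']
    refine ⟨(Q.rep l)⁻¹, funext fun i => ?_⟩
    simp [div_eq_inv_mul]
  · rintro g R a ⟨n, A, B, hA, hB, hB0, hg, rfl⟩
    have hcB : D.coord B ≠ 0 := by
      rw [Ne, coord_eq_zero_iff]
      rintro ⟨P, rfl⟩
      rw [map_mul, show eval (φ R).rep D.poly = 0 from hpt R, zero_mul] at hB0
      exact hB0 rfl
    obtain ⟨b, hb, hrep⟩ := exists_rep_mk (c R) (hc0 R)
    have hbn := pow_ne_zero n hb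
    change eval (Projectivization.mk K (c R) (hc0 R)).rep B ≠ 0 at hB0
    change SmoothModel.HasValueAt _ _ (eval (Projectivization.mk K (c R) (hc0 R)).rep A /
      eval (Projectivization.mk K (c R) (hc0 R)).rep B)
    rw [hrep _ _ hB] at hB0
    rw [hσ g n A B hA hB hcB hg, haev (j R) n A hA, haev (j R) n B hB, hrep _ _ hA, hrep _ _ hB,
      mul_div_mul_left _ _ (pow_ne_zero _ (hf0 _)), mul_div_mul_left _ _ hbn, div_eq_mul_inv,
      div_eq_mul_inv]
    exact (SmoothModel.HasValueAt.aeval (hc R) A).mul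
      ((SmoothModel.HasValueAt.aeval (hc R) B).inv (right_ne_zero_of_mul hB0))

end PlaneCurve

end GaloisPoints

end

/-! ### Relations in the function field of `w ^ m = T(z)` -/

noncomputable section

open Polynomial

namespace GaloisPoints

section Superelliptic

variable {K : Type*} [Field K]

/-- `W ^ m - T(Z)` is irreducible if `T` has a simple root. -/
theorem irreducible_X_pow_sub_C_of_simple_root {m : ℕ} (hm : 0 < m) {T : K[X]} {a : K}
    (ha : T.eval a = 0) (ha' : (derivative T).eval a ≠ 0) : Irreducible (X ^ m - C T) := by
  have hprime : Prime (X - C a : K[X]) := prime_X_sub_C a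
  have hdeg : (X ^ m - C T : K[X][X]).degree = m := degree_X_pow_sub_C hm T
  have hmon : (X ^ m - C T : K[X][X]).Monic := monic_X_pow_sub_C T hm.ne'
  have hc0 : (X ^ m - C T : K[X][X]).coeff 0 = -T := by
    simp [coeff_X_pow, hm.ne]
  refine irreducible_of_eisenstein_criterion (P := Ideal.span {X - C a})
    ((Ideal.span_singleton_prime hprime.ne_zero).2 hprime) ?_ ?_ ?_ ?_ hmon.isPrimitive
  · rw [hmon.leadingCoeff, Ideal.mem_span_singleton]
    exact fun h => hprime.not_isUnit (isUnit_of_dvd_one h)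
  · intro k hk
    rw [hdeg] at hk
    have hk' : k < m := by exact_mod_cast hk
    rw [Ideal.mem_span_singleton, coeff_sub, coeff_X_pow, if_neg hk'.ne, zero_sub, dvd_neg,
      coeff_C]
    split_ifs
    · exact dvd_iff_isRoot.2 ha
    · exact dvd_zero _
  · rw [hdeg]
    exact_mod_cast hm
  · rw [hc0, Ideal.span_singleton_pow, Ideal.mem_span_singleton, dvd_neg]
    -- If `(X - a) ^ 2` divided `T`, the derivative would vanish at `a`.
    rintro ⟨S, rfl⟩
    refine ha' ?_
    simp [derivative_mul, derivative_pow]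

variable {F : Type*} [Field F] [Algebra K F]

/-- Over an integrally closed domain the minimal polynomial of an integral element divides all its
relations; an irreducible monic relation is associated to it. -/
theorem dvd_of_monic_of_irreducible_of_aeval_eq_zero {R : Type*} [CommRing R] [IsDomain R]
    [IsIntegrallyClosed R] [Algebra R F] [FaithfulSMul R F] {E A : R[X]} (hE : E.Monic)
    (hirr : Irreducible E) {w : F} (hEw : aeval w E = 0) (hA : aeval w A = 0) : E ∣ A := by
  have hint : IsIntegral R w := ⟨E, hE, hEw⟩
  have h : Associated E (minpoly R w) :=
    (hirr.dvd_iff.1 (minpoly.isIntegrallyClosed_dvd hint hEw)).resolve_left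
      (minpoly.not_isUnit R w)
  exact h.dvd.trans (minpoly.isIntegrallyClosed_dvd hint hA)

/-- If `w ^ m = T(z)` with `z` transcendental, the relations between `z` and `w` are the multiples
of `W ^ m - T(Z)`. -/
theorem X_pow_sub_C_dvd_of_eval₂_eq_zero {m : ℕ} (hm : 0 < m) {T : K[X]}
    {a : K} (ha : T.eval a = 0) (ha' : (derivative T).eval a ≠ 0) {z w : F}
    (hz : Transcendental K z) (hw : w ^ m = aeval z T) {A : K[X][X]}
    (hA : A.eval₂ (aeval z : K[X] →ₐ[K] F).toRingHom w = 0) : (X ^ m - C T) ∣ A := by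
  let : Algebra K[X] F := (aeval z : K[X] →ₐ[K] F).toRingHom.toAlgebra
  have hinj : Function.Injective (algebraMap K[X] F) := transcendental_iff_injective.1 hz
  have : FaithfulSMul K[X] F := (faithfulSMul_iff_algebraMap_injective K[X] F).2 hinj
  refine dvd_of_monic_of_irreducible_of_aeval_eq_zero (monic_X_pow_sub_C T hm.ne')
    (irreducible_X_pow_sub_C_of_simple_root hm ha ha') (w := w) ?_ hA
  rw [map_sub, map_pow, aeval_X, aeval_C, hw]
  exact sub_self _

/-- The substitution `Z ↦ ζ Z`. -/
def twist (ζ : K) : K[X] →+* K[X] := compRingHom (C ζ * X)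

theorem coeff_twist (ζ : K) (T : K[X]) (k : ℕ) : (twist ζ T).coeff k = T.coeff k * ζ ^ k := by
  rw [twist, coe_compRingHom_apply, comp_C_mul_X_coeff]

theorem twist_twist (ζ ξ : K) (T : K[X]) : twist ζ (twist ξ T) = twist (ξ * ζ) T := by
  ext k
  simp only [coeff_twist]
  ring

theorem twist_one (T : K[X]) : twist 1 T = T := by
  ext k
  simp [coeff_twist]

theorem eval_twist (ζ c : K) (T : K[X]) : (twist ζ T).eval c = T.eval (ζ * c) := by
  simp [twist]

theorem derivative_twist (ζ : K) (T : K[X]) :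
    derivative (twist ζ T) = C ζ * twist ζ (derivative T) := by
  simp [twist, derivative_comp]

theorem natDegree_twist_le (ζ : K) (T : K[X]) : (twist ζ T).natDegree ≤ T.natDegree := by
  rw [natDegree_le_iff_coeff_eq_zero]
  intro k hk
  rw [coeff_twist, coeff_eq_zero_of_natDegree_lt hk, zero_mul]

theorem aeval_twist {A : Type*} [CommRing A] [Algebra K A] (ζ : K) (T : K[X]) (z : A) :
    aeval z (twist ζ T) = aeval (algebraMap K A ζ * z) T := by
  simp [twist, aeval_comp]

theorem twist_expand {N : ℕ} {ζ : K} (hζ : ζ ^ N = 1) (T : K[X]) :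
    twist ζ (expand K N T) = expand K N T := by
  rw [twist, coe_compRingHom_apply, expand_eq_comp_X_pow, comp_assoc]
  congr 1
  simp [mul_pow, ← C_pow, hζ]

theorem card_nthRootsFinset_one [IsAlgClosed K] {N : ℕ} (hN : (N : K) ≠ 0) :
    (nthRootsFinset N (1 : K)).card = N := by
  have : NeZero (N : K) := ⟨hN⟩
  obtain ⟨ζ, hζ⟩ := HasEnoughRootsOfUnity.exists_primitiveRoot K N
  exact hζ.card_nthRootsFinset

/-- No nontrivial polynomial relation between `z ^ N` and `w` of degree less than `m * N` in `w`. -/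
theorem eq_zero_of_eval₂_pow_eq_zero [IsAlgClosed K] {m N : ℕ} (hm : 0 < m) (hN : (N : K) ≠ 0)
    {T : K[X]} {a : K} (ha : T.eval a = 0) (ha' : (derivative T).eval a ≠ 0)
    (hT : ∀ ζ : K, ζ ^ N = 1 → twist ζ T = T → ζ = 1) {z w : F}
    (hz : Transcendental K z) (hw : w ^ m = aeval z T) {A : K[X][X]} (hdeg : A.degree < (m * N : ℕ))
    (hA : A.eval₂ (aeval (z ^ N) : K[X] →ₐ[K] F).toRingHom w = 0) : A = 0 := by
  have hN0 : 0 < N := Nat.pos_of_ne_zero fun h => hN (by rw [h, Nat.cast_zero])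
  have hinj : Function.Injective (expand K N : K[X] →ₐ[K] K[X]).toRingHom := expand_injective hN0
  -- `B(Z, W) = A(Z ^ N, W)` is a relation between `z` and `w`, and it is unchanged by every
  -- substitution `Z ↦ ζ Z` with `ζ ^ N = 1`.
  set B : K[X][X] := A.map (expand K N : K[X] →ₐ[K] K[X]).toRingHom with hB
  have h1 : (X ^ m - C T) ∣ B := by
    refine X_pow_sub_C_dvd_of_eval₂_eq_zero hm ha ha' hz hw ?_
    rw [hB, eval₂_map]
    convert hA using 2
    refine RingHom.ext fun p => ?_
    exact expand_aeval N p z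
  have hmem : ∀ ζ ∈ nthRootsFinset N (1 : K), ζ ^ N = 1 := fun ζ h => (mem_nthRootsFinset hN0 _).1 h
  have hζ0 : ∀ ζ ∈ nthRootsFinset N (1 : K), ζ ≠ 0 := by
    rintro ζ h rfl
    have := hmem _ h
    rw [zero_pow hN0.ne'] at this
    exact zero_ne_one this
  have h2 : ∀ ζ ∈ nthRootsFinset N (1 : K), (X ^ m - C (twist ζ T)) ∣ B := by
    intro ζ hζ
    have h := map_dvd (mapRingHom (twist ζ)) h1
    simp only [coe_mapRingHom, Polynomial.map_sub, Polynomial.map_pow, map_X, map_C] at h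
    convert h using 1
    rw [hB, Polynomial.map_map]
    congr 1
    exact RingHom.ext fun p => (twist_expand (hmem ζ hζ) p).symm
  have hirr : ∀ ζ ∈ nthRootsFinset N (1 : K), Prime (X ^ m - C (twist ζ T) : K[X][X]) := by
    intro ζ hζ
    refine (irreducible_X_pow_sub_C_of_simple_root (a := ζ⁻¹ * a) hm ?_ ?_).prime
    · rw [eval_twist, mul_inv_cancel_left₀ (hζ0 ζ hζ), ha]
    · rw [derivative_twist, eval_mul, eval_C, eval_twist, mul_inv_cancel_left₀ (hζ0 ζ hζ)]
      exact mul_ne_zero (hζ0 ζ hζ) ha'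
  have hmon : ∀ ζ ∈ nthRootsFinset N (1 : K), (X ^ m - C (twist ζ T) : K[X][X]).Monic :=
    fun ζ _ => monic_X_pow_sub_C _ hm.ne'
  -- If the primes for `ζ` and `ξ` were associated, then `T` would be fixed by the rotation `ζ *
  -- ξ⁻¹`, so `ζ = ξ` by `hT`. Hence the product of all of them, of degree `m * N`, divides `B`.
  have hco : (∏ ζ ∈ nthRootsFinset N (1 : K), (X ^ m - C (twist ζ T) : K[X][X])) ∣ B := by
    refine Finset.prod_dvd_of_isRelPrime ?_ h2
    intro ζ hζ ξ hξ hne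
    refine ((hirr ζ hζ).irreducible.isRelPrime_iff_not_dvd).2 fun hd => hne ?_
    have heq := eq_of_monic_of_associated (hmon ζ hζ) (hmon ξ hξ)
      ((hirr ζ hζ).irreducible.associated_of_dvd (hirr ξ hξ).irreducible hd)
    rw [sub_right_inj, C_inj] at heq
    have h3 : twist (ζ * ξ⁻¹) T = T := by
      rw [← twist_twist, heq, twist_twist, mul_inv_cancel₀ (hζ0 ξ hξ), twist_one]
    have h4 := hT _ (by rw [mul_pow, inv_pow, hmem ζ hζ, hmem ξ hξ, inv_one, one_mul]) h3
    exact (mul_inv_eq_one₀ (hζ0 ξ hξ)).1 h4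
  have hprod : (∏ ζ ∈ nthRootsFinset N (1 : K), (X ^ m - C (twist ζ T) : K[X][X])).degree
      = (m * N : ℕ) := by
    rw [degree_prod, Finset.sum_congr rfl fun ζ _ => degree_X_pow_sub_C hm (twist ζ T),
      Finset.sum_const, card_nthRootsFinset_one hN, nsmul_eq_mul, mul_comm]
    norm_cast
  have hB0 : B = 0 := by
    refine eq_zero_of_dvd_of_degree_lt hco ?_
    rw [hprod, hB, degree_map_eq_of_injective hinj]
    exact hdeg
  rwa [hB, Polynomial.map_eq_zero_iff hinj] at hB0

/-- The norm `∏ (Y - T(ζ Z))` over the `N`-th roots of unity `ζ`. -/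
def twistProd (N : ℕ) (T : K[X]) : K[X][X] :=
  ∏ ζ ∈ nthRootsFinset N (1 : K), (X - C (twist ζ T))

/-- Multiplication by `ζ` permutes the `N`-th roots of unity, hence the factors. -/
theorem map_twist_twistProd {N : ℕ} {ζ : K} (hζ : ζ ^ N = 1) (hN : 0 < N) (T : K[X]) :
    (twistProd N T).map (twist ζ) = twistProd N T := by
  have hζ0 : ζ ≠ 0 := by
    rintro rfl
    rw [zero_pow hN.ne'] at hζ
    exact zero_ne_one hζ
  rw [twistProd, Polynomial.map_prod]
  refine Finset.prod_bij' (fun ξ _ => ξ * ζ) (fun ξ _ => ξ * ζ⁻¹) ?_ ?_ ?_ ?_ ?_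
  · intro ξ hξ
    rw [mem_nthRootsFinset hN] at hξ ⊢
    rw [mul_pow, hξ, hζ, one_mul]
  · intro ξ hξ
    rw [mem_nthRootsFinset hN] at hξ ⊢
    rw [mul_pow, inv_pow, hξ, hζ, one_mul, inv_one]
  · intro ξ _
    exact mul_inv_cancel_right₀ hζ0 ξ
  · intro ξ _
    exact inv_mul_cancel_right₀ hζ0 ξ
  · intro ξ _
    simp [twist_twist]

/-- Invariance under `Z ↦ ζ Z` for a primitive `ζ` forces every exponent that occurs to be divisible
by `N`: the norm is a polynomial in `Z ^ N`. -/
theorem expand_contract_coeff_twistProd [IsAlgClosed K] {N : ℕ} (hN : (N : K) ≠ 0) (T : K[X])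
    (j : ℕ) :
    expand K N (contract N ((twistProd N T).coeff j)) = (twistProd N T).coeff j := by
  have hN0 : 0 < N := Nat.pos_of_ne_zero fun h => hN (by rw [h, Nat.cast_zero])
  have : NeZero (N : K) := ⟨hN⟩
  obtain ⟨ζ, hζ⟩ := HasEnoughRootsOfUnity.exists_primitiveRoot K N
  have h := congrArg (fun p => p.coeff j) (map_twist_twistProd hζ.pow_eq_one hN0 T)
  simp only [coeff_map] at h
  ext k
  rw [coeff_expand hN0]
  split_ifs with hk
  · rw [coeff_contract hN0.ne', Nat.div_mul_cancel hk]
  · have h' := congrArg (fun p => p.coeff k) h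
    simp only [coeff_twist] at h'
    by_contra hne
    exact hk (hζ.dvd_of_pow_eq_one k (mul_left_cancel₀ (Ne.symm hne) (h'.trans (mul_one _).symm)))

theorem natDegree_coeff_prod_X_sub_C_le {R ι : Type*} [CommRing R] (s : Finset ι)
    (a : ι → R[X]) {d : ℕ} (ha : ∀ i ∈ s, (a i).natDegree ≤ d) (j : ℕ) :
    ((∏ i ∈ s, (X - C (a i))).coeff j).natDegree ≤ (s.card - j) * d := by
  classical
  induction s using Finset.induction_on generalizing j with
  | empty =>
    rw [Finset.prod_empty, coeff_one]
    split_ifs <;> simp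
  | insert i s hi ih =>
    have ih' := ih fun k hk => ha k (Finset.mem_insert_of_mem hk)
    rw [Finset.prod_insert hi, Finset.card_insert_of_notMem hi, sub_mul, coeff_sub, coeff_C_mul]
    refine (natDegree_sub_le _ _).trans (max_le ?_ ?_)
    · rcases j with _ | j
      · simp
      · rw [coeff_X_mul, Nat.add_sub_add_right]
        exact ih' j
    -- For `j > s.card` the truncated bound has no room for the factor `a i`, but then the
    -- coefficient of the smaller product is zero.
    · by_cases hj : s.card < j
      · have h0 : (∏ i ∈ s, (X - C (a i))).coeff j = 0 := by
          refine coeff_eq_zero_of_natDegree_lt (lt_of_le_of_lt (natDegree_prod_le _ _) ?_)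
          refine lt_of_le_of_lt (Finset.sum_le_sum fun k _ => natDegree_X_sub_C_le (a k)) ?_
          simpa using hj
        rw [h0, mul_zero]
        simp
      · refine natDegree_mul_le.trans ?_
        calc _ ≤ d + (s.card - j) * d :=
              Nat.add_le_add (ha i (Finset.mem_insert_self _ _)) (ih' j)
          _ = (s.card + 1 - j) * d := by
              rw [show s.card + 1 - j = (s.card - j) + 1 by omega]
              ring

/-- This bound ensures that homogenizing to degree `m * (N - j)` in `normForm` discards no term. -/
theorem natDegree_contract_coeff_twistProd_le [IsAlgClosed K] {m N : ℕ} (hN : (N : K) ≠ 0)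
    {T : K[X]} (hT : T.natDegree ≤ m * N) (j : ℕ) :
    (contract N ((twistProd N T).coeff j)).natDegree ≤ m * (N - j) := by
  have hN0 : 0 < N := Nat.pos_of_ne_zero fun h => hN (by rw [h, Nat.cast_zero])
  have h1 : ((twistProd N T).coeff j).natDegree ≤ _ :=
    natDegree_coeff_prod_X_sub_C_le (nthRootsFinset N (1 : K))
    (fun ζ => twist ζ T) (d := m * N) (fun ζ _ => (natDegree_twist_le ζ T).trans hT) j
  rw [card_nthRootsFinset_one hN, ← expand_contract_coeff_twistProd hN T j, natDegree_expand] at h1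
  refine Nat.le_of_mul_le_mul_right (h1.trans_eq ?_) hN0
  ring

theorem coeff_card_twistProd [IsAlgClosed K] {N : ℕ} (hN : (N : K) ≠ 0) (T : K[X]) :
    (twistProd N T).coeff N = 1 ∧ (twistProd N T).natDegree = N := by
  have hmon : (twistProd N T).Monic := monic_prod_of_monic _ _ fun ζ _ => monic_X_sub_C _
  have hdeg : (twistProd N T).natDegree = N := by
    rw [twistProd, natDegree_prod_of_monic _ _ fun ζ _ => monic_X_sub_C _]
    simp [card_nthRootsFinset_one hN]
  refine ⟨?_, hdeg⟩
  have h := hmon.coeff_natDegree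
  rwa [hdeg] at h

end Superelliptic

end GaloisPoints

end

/-! ### Homogeneous relations of `(w : v : 1)` -/

noncomputable section

open MvPolynomial

namespace GaloisPoints

section Relations

variable {K F : Type*} [Field K] [Field F] [Algebra K F]

/-- Evaluation along the cone over the point `f`. -/
def coneEval (f : Fin 3 → F) : MvPolynomial (Fin 3) K →ₐ[K] Polynomial F :=
  aeval fun i => Polynomial.X * Polynomial.C (f i)

theorem coneEval_of_isHomogeneous (f : Fin 3 → F) {n : ℕ} {P : MvPolynomial (Fin 3) K}
    (hP : P.IsHomogeneous n) : coneEval f P = Polynomial.X ^ n * Polynomial.C (aeval f P) := by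
  rw [coneEval, aeval_mul_left_of_isHomogeneous hP]
  congr 1
  exact aeval_algebraMap_apply (Polynomial F) f P

/-- The cone parameter separates the degrees, so the kernel of `coneEval` is a homogeneous ideal. -/
theorem coeff_coneEval (f : Fin 3 → F) (P : MvPolynomial (Fin 3) K) (n : ℕ) :
    (coneEval f P).coeff n = aeval f (homogeneousComponent n P) := by
  conv_lhs => rw [← P.sum_homogeneousComponent]
  rw [map_sum, Polynomial.finsetSum_coeff, Finset.sum_congr rfl fun i _ => by
    rw [coneEval_of_isHomogeneous f (homogeneousComponent_isHomogeneous i P),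
      Polynomial.coeff_X_pow_mul', Polynomial.coeff_C]]
  by_cases hn : n < P.totalDegree + 1
  · rw [Finset.sum_eq_single_of_mem n (Finset.mem_range.2 hn)]
    · simp
    · intro i _ hi
      split_ifs with h1 h2
      · omega
      · rfl
      · rfl
  · rw [homogeneousComponent_eq_zero _ _ (by omega), map_zero]
    refine Finset.sum_eq_zero fun i hi => ?_
    rw [Finset.mem_range] at hi
    split_ifs with h1 h2
    · omega
    · rfl
    · rfl

theorem aeval_eq_eval₂_finSuccEquiv (w v : F) (P : MvPolynomial (Fin 3) K) :
    aeval ![w, v, 1] P = ((finSuccEquiv K 2 P).map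
      (aeval ![Polynomial.X, 1] : MvPolynomial (Fin 2) K →ₐ[K] Polynomial K).toRingHom).eval₂
      (Polynomial.aeval v : Polynomial K →ₐ[K] F).toRingHom w := by
  induction P using MvPolynomial.induction_on with
  | C a =>
    rw [finSuccEquiv_apply]
    simp
  | add P Q hP hQ => rw [map_add, map_add, Polynomial.map_add, Polynomial.eval₂_add, hP, hQ]
  | mul_X P i hP =>
    rw [map_mul, map_mul, Polynomial.map_mul, Polynomial.eval₂_mul, hP, aeval_X]
    congr 1
    refine Fin.cases ?_ (fun i => ?_) i
    · rw [finSuccEquiv_X_zero]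
      simp
    · rw [finSuccEquiv_X_succ]
      fin_cases i <;> simp

/-- A form with small degree in the first variable that vanishes at `(w : v : 1)` is zero, if this
holds for polynomials. -/
theorem eq_zero_of_isHomogeneous_of_aeval_eq_zero {d : ℕ} {w v : F}
    (hind : ∀ A : Polynomial (Polynomial K), A.degree < d →
      A.eval₂ (Polynomial.aeval v : Polynomial K →ₐ[K] F).toRingHom w = 0 → A = 0)
    {n : ℕ} {P : MvPolynomial (Fin 3) K} (hP : P.IsHomogeneous n) (hPd : P.degreeOf 0 < d)
    (hP0 : aeval ![w, v, 1] P = 0) : P = 0 := by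
  have h := hind _ ?_ ((aeval_eq_eval₂_finSuccEquiv w v P).symm.trans hP0)
  · rw [← map_eq_zero_iff _ (finSuccEquiv K 2).injective]
    ext1 i
    by_cases hi : i ≤ n
    · obtain ⟨j, rfl⟩ := Nat.exists_eq_add_of_le hi
      have hc := hP.finSuccEquiv_coeff_isHomogeneous i j rfl
      have h0 := congrArg (fun p => p.coeff i) h
      simp only [Polynomial.coeff_map, Polynomial.coeff_zero] at h0
      -- A binary form of known degree is recovered from its dehomogenization, which is zero here.
      rw [← Polynomial.homogenize_eq_of_isHomogeneous hc h0, Polynomial.homogenize_zero,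
        Polynomial.coeff_zero]
    · refine Polynomial.coeff_eq_zero_of_natDegree_lt ?_
      rw [natDegree_finSuccEquiv]
      exact lt_of_le_of_lt ((degreeOf_le_totalDegree P 0).trans hP.totalDegree_le) (by omega)
  · refine lt_of_le_of_lt (Polynomial.degree_map_le) ?_
    refine lt_of_le_of_lt Polynomial.degree_le_natDegree ?_
    rw [natDegree_finSuccEquiv]
    exact_mod_cast hPd

/-- The relations of the cone over `(w : v : 1)` are the multiples of a given form, monic of degree
`d` in the first variable, if there are none of smaller degree. -/
theorem coneEval_eq_zero_iff_dvd {d : ℕ} (hd : 0 < d) {w v : F}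
    (hind : ∀ A : Polynomial (Polynomial K), A.degree < d →
      A.eval₂ (Polynomial.aeval v : Polynomial K →ₐ[K] F).toRingHom w = 0 → A = 0)
    {G : MvPolynomial (Fin 3) K} {e : ℕ} (hG : G.IsHomogeneous e)
    (hGmon : (finSuccEquiv K 2 G).Monic)
    (hGdeg : (finSuccEquiv K 2 G).natDegree = d) (hG0 : aeval ![w, v, 1] G = 0)
    (P : MvPolynomial (Fin 3) K) : coneEval ![w, v, 1] P = 0 ↔ G ∣ P := by
  have hG0' : coneEval ![w, v, 1] G = 0 := by
    rw [coneEval_of_isHomogeneous _ hG, hG0, map_zero, mul_zero]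
  constructor
  · intro hP
    set S := (finSuccEquiv K 2).symm (finSuccEquiv K 2 P /ₘ finSuccEquiv K 2 G) with hS
    have hdiv : finSuccEquiv K 2 (P - G * S) = finSuccEquiv K 2 P %ₘ finSuccEquiv K 2 G := by
      rw [map_sub, map_mul, hS, AlgEquiv.apply_symm_apply, Polynomial.modByMonic_eq_sub_mul_div]
    -- The remainder of division by `G` in the first variable is again a relation. Its homogeneous
    -- components are relations of degree below `d` in that variable, so they vanish by `hind`.
    have hR : P - G * S = 0 := by
      have hdegR : (P - G * S).degreeOf 0 < d := by
        rw [← natDegree_finSuccEquiv, hdiv, ← hGdeg]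
        refine Polynomial.natDegree_modByMonic_lt _ hGmon fun h1 => ?_
        rw [h1, Polynomial.natDegree_one] at hGdeg
        omega
      rw [← (P - G * S).sum_homogeneousComponent]
      refine Finset.sum_eq_zero fun n _ => ?_
      refine eq_zero_of_isHomogeneous_of_aeval_eq_zero hind
        (homogeneousComponent_isHomogeneous n _) ?_ ?_
      · rw [degreeOf_lt_iff hd] at hdegR ⊢
        intro s hs
        rw [support_homogeneousComponent, Finset.mem_filter] at hs
        exact hdegR s hs.1
      · rw [← coeff_coneEval, map_sub, map_mul, hP, hG0', zero_mul, sub_zero,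
          Polynomial.coeff_zero]
    rw [sub_eq_zero.1 hR]
    exact dvd_mul_right _ _
  · rintro ⟨S, rfl⟩
    rw [map_mul, hG0', zero_mul]

/-- The target `F[t]` is a domain, so the kernel, here generated by `G`, is a prime ideal. -/
theorem irreducible_of_coneEval_eq_zero_iff_dvd {f : Fin 3 → F} {G : MvPolynomial (Fin 3) K}
    (hG0 : G ≠ 0) (h : ∀ P : MvPolynomial (Fin 3) K, coneEval f P = 0 ↔ G ∣ P) :
    Irreducible G := by
  refine Prime.irreducible ⟨hG0, ?_, ?_⟩
  · intro hu
    have h1 := (h 1).2 hu.dvd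
    rw [map_one] at h1
    exact one_ne_zero h1
  · intro A B hAB
    rw [← h, map_mul] at hAB
    rw [← h, ← h]
    exact mul_eq_zero.1 hAB

end Relations

/-! ### The norm as a ternary form -/

section NormForm

variable {K : Type*} [Field K]

/-- The form `G` with `G(w, z ^ N, 1) = ∏ (w ^ m - T(ζ z))`, the product being over the `N`-th roots
of unity `ζ`. -/
def normForm (m N : ℕ) (T : Polynomial K) : MvPolynomial (Fin 3) K :=
  ∑ j ∈ Finset.range (N + 1), X 0 ^ (m * j) *
    rename Fin.succ (((twistProd N T).coeff j).contract N |>.homogenize (m * (N - j)))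

theorem normForm_isHomogeneous (m N : ℕ) (T : Polynomial K) :
    (normForm m N T).IsHomogeneous (m * N) := by
  refine IsHomogeneous.sum _ _ _ fun j hj => ?_
  rw [Finset.mem_range] at hj
  have h := (isHomogeneous_X_pow (R := K) (0 : Fin 3) (m * j)).mul
    ((Polynomial.isHomogeneous_homogenize (n := m * (N - j))
      (((twistProd N T).coeff j).contract N)).rename_isHomogeneous (f := Fin.succ))
  rwa [← mul_add, show j + (N - j) = N by omega] at h

theorem finSuccEquiv_rename_succ (P : MvPolynomial (Fin 2) K) :
    finSuccEquiv K 2 (rename Fin.succ P) = Polynomial.C P := by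
  induction P using MvPolynomial.induction_on with
  | C a => simp [finSuccEquiv_apply]
  | add P Q hP hQ => simp [hP, hQ]
  | mul_X P i hP => rw [map_mul, map_mul, hP, rename_X, finSuccEquiv_X_succ, Polynomial.C_mul]

theorem finSuccEquiv_normForm (m N : ℕ) (T : Polynomial K) :
    finSuccEquiv K 2 (normForm m N T) = ∑ j ∈ Finset.range (N + 1),
      Polynomial.C (((twistProd N T).coeff j).contract N |>.homogenize (m * (N - j))) *
        Polynomial.X ^ (m * j) := by
  rw [normForm, map_sum]
  refine Finset.sum_congr rfl fun j _ => ?_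
  rw [map_mul, map_pow, finSuccEquiv_X_zero, finSuccEquiv_rename_succ, mul_comm]

/-- The coefficients of `normForm` on the line `X 0 = 0` are those of `∏ (- T(ζ Z))`. -/
theorem eval_normForm_of_eq_zero (m : ℕ) {N : ℕ} (T : Polynomial K) (c : Fin 3 → K) (hc : c 0 = 0)
    (hm : 0 < m) :
    eval c (normForm m N T) = eval (fun i => c (Fin.succ i))
      ((((twistProd N T).coeff 0).contract N).homogenize (m * N)) := by
  rw [normForm, map_sum, Finset.sum_eq_single_of_mem 0 (by simp)]
  · simp [eval_rename, Function.comp_def]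
  · intro j _ hj
    simp [hc, hm.ne', hj]

variable [IsAlgClosed K]

theorem monic_finSuccEquiv_normForm {m N : ℕ} (hm : 0 < m) (hN : (N : K) ≠ 0)
    (T : Polynomial K) :
    (finSuccEquiv K 2 (normForm m N T)).Monic ∧
      (finSuccEquiv K 2 (normForm m N T)).natDegree = m * N := by
  have hc : ((twistProd N T).coeff N).contract N = 1 := by
    rw [(coeff_card_twistProd hN T).1, ← Polynomial.C_1, Polynomial.contract_C]
  have h : finSuccEquiv K 2 (normForm m N T) = Polynomial.X ^ (m * N) +
      ∑ j ∈ Finset.range N,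
      Polynomial.C (((twistProd N T).coeff j).contract N |>.homogenize (m * (N - j))) *
        Polynomial.X ^ (m * j) := by
    rw [finSuccEquiv_normForm, Finset.sum_range_succ, hc, Nat.sub_self, mul_zero,
      Polynomial.homogenize_one, pow_zero, Polynomial.C_1, one_mul, add_comm]
  have hlt : (∑ j ∈ Finset.range N,
      Polynomial.C (((twistProd N T).coeff j).contract N |>.homogenize (m * (N - j))) *
        Polynomial.X ^ (m * j)).degree < ((m * N : ℕ) : WithBot ℕ) := by
    refine lt_of_le_of_lt (Polynomial.degree_sum_le _ _) ?_
    rw [Finset.sup_lt_iff (WithBot.bot_lt_coe _)]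
    intro j hj
    refine lt_of_le_of_lt (Polynomial.degree_C_mul_X_pow_le _ _) ?_
    exact_mod_cast Nat.mul_lt_mul_of_pos_left (Finset.mem_range.1 hj) hm
  rw [h]
  refine ⟨Polynomial.monic_X_pow_add hlt, ?_⟩
  refine Polynomial.natDegree_eq_of_degree_eq_some ?_
  rw [Polynomial.degree_add_eq_left_of_degree_lt] <;> rw [Polynomial.degree_X_pow]
  exact hlt

/-- Evaluating a contracted coefficient at `z ^ N` undoes the contraction, so the left side is
`twistProd` evaluated at `z` and `w ^ m`. -/
theorem aeval_normForm {m N : ℕ} (hN : (N : K) ≠ 0)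
    {T : Polynomial K} (hT : T.natDegree ≤ m * N) {A : Type*} [CommRing A] [Algebra K A] (w z : A) :
    aeval ![w, z ^ N, 1] (normForm m N T) =
      ∏ ζ ∈ Polynomial.nthRootsFinset N (1 : K),
        (w ^ m - Polynomial.aeval (algebraMap K A ζ * z) T) := by
  have h1 : aeval ![w, z ^ N, 1] (normForm m N T) = (twistProd N T).eval₂
      (Polynomial.aeval z : Polynomial K →ₐ[K] A).toRingHom (w ^ m) := by
    rw [Polynomial.eval₂_eq_sum_range, (coeff_card_twistProd hN T).2, normForm, map_sum]
    refine Finset.sum_congr rfl fun j _ => ?_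
    rw [map_mul, map_pow, aeval_X, aeval_rename, mul_comm, ← pow_mul]
    congr 1
    rw [Polynomial.aeval_homogenize_of_eq_one (natDegree_contract_coeff_twistProd_le hN hT j)]
    · conv_rhs => rw [← expand_contract_coeff_twistProd hN T j]
      exact (Polynomial.expand_aeval _ _ _).symm
    · rfl
  rw [h1, twistProd, Polynomial.eval₂_finsetProd]
  refine Finset.prod_congr rfl fun ζ _ => ?_
  rw [Polynomial.eval₂_sub, Polynomial.eval₂_X, Polynomial.eval₂_C]
  congr 1
  exact aeval_twist ζ T z

end NormForm

end GaloisPoints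

end

/-! ### Galois extensions of Kummer and additive type -/

noncomputable section

open Polynomial

namespace GaloisPoints

section Galois

variable {K L : Type*} [Field K] [Field L] [Algebra K L]

open IntermediateField

theorem isGalois_of_le {S S' : IntermediateField K L} (h : S ≤ S') [IsGalois S L] :
    IsGalois S' L := by
  let : Algebra S S' := (inclusion h).toRingHom.toAlgebra
  have : IsScalarTower S S' L := IsScalarTower.of_algebraMap_eq fun _ => rfl
  exact IsGalois.tower_top_of_isGalois S S' L

/-- `L` is generated over `S` by one root of a separable polynomial that splits in `L`, hence is its
splitting field. Finiteness is kept for the study of valuation rings over `K(x)`. -/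
theorem isGalois_and_finiteDimensional_of_root {S : IntermediateField K L} (P : S[X])
    (hsep : P.Separable) (hspl : (P.map (algebraMap S L)).Splits) {u : L} (hu : aeval u P = 0)
    (htop : adjoin K (insert u (S : Set L)) = ⊤) :
    IsGalois S L ∧ FiniteDimensional S L := by
  have hP : P.IsSplittingField S L := by
    rw [isSplittingField_iff_intermediateField]
    refine ⟨hspl, ?_⟩
    rw [← restrictScalars_eq_top_iff (K := K), ← top_le_iff, ← htop, adjoin_le_iff,
      Set.insert_subset_iff]
    constructor
    · exact subset_adjoin S _ ((mem_rootSet_of_ne hsep.ne_zero).2 hu)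
    · intro s hs
      exact (adjoin S (P.rootSet L)).algebraMap_mem ⟨s, hs⟩
  exact ⟨IsGalois.of_separable_splitting_field hsep, IsSplittingField.finiteDimensional L P⟩

/-- Kummer extensions. -/
theorem isGalois_of_pow_mem [IsAlgClosed K] {S : IntermediateField K L} {u : L} {n : ℕ}
    (hn : (n : K) ≠ 0) (hu0 : u ≠ 0) (hu : u ^ n ∈ S)
    (htop : adjoin K (insert u (S : Set L)) = ⊤) : IsGalois S L ∧ FiniteDimensional S L := by
  have : NeZero (n : K) := ⟨hn⟩
  obtain ⟨ζ, hζ⟩ := HasEnoughRootsOfUnity.exists_primitiveRoot K n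
  refine isGalois_and_finiteDimensional_of_root (X ^ n - C ⟨u ^ n, hu⟩) ?_ ?_ (u := u) ?_ htop
  · refine separable_X_pow_sub_C _ ?_ ?_
    · rw [← map_natCast (algebraMap K S), Ne, map_eq_zero]
      exact hn
    · intro h
      exact pow_ne_zero n hu0 (congrArg Subtype.val h)
  · rw [Polynomial.map_sub, Polynomial.map_pow, map_X, map_C]
    exact X_pow_sub_C_splits_of_isPrimitiveRoot
      (hζ.map_of_injective (algebraMap K L).injective) rfl
  · rw [map_sub, map_pow, aeval_X, aeval_C]
    exact sub_self _

/-- Extensions by a root of the additive polynomial `X ^ q + X`. -/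
theorem isGalois_of_pow_add_mem [IsAlgClosed K] {S : IntermediateField K L} {u : L} {p n q : ℕ}
    [Fact p.Prime] [CharP K p] (hn : 0 < n) (hq : q = p ^ n) (hu : u ^ q + u ∈ S)
    (htop : adjoin K (insert u (S : Set L)) = ⊤) : IsGalois S L ∧ FiniteDimensional S L := by
  have hp : CharP L p := charP_of_injective_algebraMap (algebraMap K L).injective p
  have hpS : CharP S p := charP_of_injective_algebraMap (algebraMap K S).injective p
  have hqp : (q : S) = 0 := by
    rw [hq, Nat.cast_pow, CharP.cast_eq_zero, zero_pow hn.ne']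
  refine isGalois_and_finiteDimensional_of_root (X ^ q + X - C ⟨u ^ q + u, hu⟩) ?_ ?_ (u := u) ?_
    htop
  · refine separable_def _ |>.2 ?_
    have hd : derivative (X ^ q + X - C ⟨u ^ q + u, hu⟩ : S[X]) = 1 := by
      rw [derivative_sub, derivative_add, derivative_X_pow, derivative_X, derivative_C, hqp]
      simp
    rw [hd]
    exact isCoprime_one_right
  -- By additivity the roots are the translates by `u` of the roots of `X ^ q + X`, which lie in
  -- `K`.
  · have h1 : (X ^ q + X - C ⟨u ^ q + u, hu⟩ : S[X]).map (algebraMap S L)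
        = ((X ^ q + X : K[X]).map (algebraMap K L)).comp (X - C u) := by
      simp only [Polynomial.map_sub, Polynomial.map_add, Polynomial.map_pow, map_X, map_C,
        add_comp, pow_comp, X_comp]
      have h2 : (X - C u : L[X]) ^ q = X ^ q - C u ^ q := by
        rw [hq, sub_pow_char_pow]
      rw [h2]
      change _ - C (u ^ q + u) = _
      rw [C_add, C_pow]
      ring
    rw [h1]
    exact (((IsAlgClosed.splits (X ^ q + X : K[X])).map (algebraMap K L)).comp_X_sub_C u)
  · rw [map_sub, map_add, map_pow, aeval_X, aeval_C]
    exact sub_self _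

theorem isGalois_adjoin_simple_map {L' : Type*} [Field L'] [Algebra K L'] (σ : L ≃ₐ[K] L') {w : L}
    [IsGalois K⟮w⟯ L] : IsGalois K⟮σ w⟯ L' := by
  have h : IsGalois ((K⟮w⟯).map σ.toAlgHom) L' :=
    IsGalois.of_equiv_equiv (F := K⟮w⟯) (E := L)
      (f := (intermediateFieldMap σ K⟮w⟯).toRingEquiv) (g := σ.toRingEquiv) (by
        ext x
        rfl)
  rw [adjoin_map, Set.image_singleton] at h
  exact h

/-- If `w ^ m = T(z)`, where no rotation of order dividing `N` fixes `T`, and `K(z, w)` is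
Galois over `K(w)`, then `w` and `z ^ N` generate `K(z, w)`. -/
theorem adjoin_pow_eq_top {m N : ℕ} {T : K[X]} {z w : L} (hN : 0 < N) [IsAlgClosed K]
    (hT : ∀ ζ : K, ζ ^ N = 1 → twist ζ T = T → ζ = 1) (hz : Transcendental K z)
    (hw : w ^ m = aeval z T) (hgen : adjoin K {z, w} = ⊤) [IsGalois K⟮w⟯ L]
    {E : IntermediateField K L} (hwE : w ∈ E) (hzE : z ^ N ∈ E) : E = ⊤ := by
  have : IsGalois E L := isGalois_of_le (adjoin_simple_le_iff.2 hwE)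
  have hz0 : z ≠ 0 := by
    rintro rfl
    exact hz (isAlgebraic_zero)
  -- An automorphism over `E` multiplies `z` by an `N`-th root of unity `ζ`, which lies in `K`; as
  -- it fixes `w`, `T(ζ z) = T(z)`, and transcendence of `z` makes this an identity of polynomials.
  have hzmem : z ∈ (⊥ : IntermediateField E L) := by
    rw [InfiniteGalois.mem_bot_iff_fixed]
    intro g
    have h1 : g z ^ N = z ^ N := by
      rw [← map_pow]
      exact g.commutes ⟨_, hzE⟩
    have h2 : (g z / z) ^ N = 1 := by
      rw [div_pow, h1, div_self (pow_ne_zero _ hz0)]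
    obtain ⟨ζ, hζ⟩ : ∃ ζ : K, algebraMap K L ζ = g z / z := by
      have halg : IsIntegral K (g z / z) :=
        ⟨X ^ N - 1, monic_X_pow_sub_C 1 hN.ne', by simp [eval₂_sub, h2]⟩
      exact minpoly.mem_range_of_degree_eq_one K _
        (IsAlgClosed.degree_eq_one_of_irreducible K (minpoly.irreducible halg))
    have hζN : ζ ^ N = 1 := by
      apply (algebraMap K L).injective
      rw [map_pow, hζ, h2, map_one]
    have hgz : g z = algebraMap K L ζ * z := by
      rw [hζ, div_mul_cancel₀ _ hz0]
    have h3 : aeval z (twist ζ T) = aeval z T := by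
      have hgw : g w = w := g.commutes ⟨w, hwE⟩
      have h := aeval_algHom_apply (g.restrictScalars K) z T
      rw [← hw, map_pow] at h
      change aeval (g z) T = g w ^ m at h
      rw [aeval_twist, ← hgz, h, hgw, hw]
    have h4 := hT ζ hζN (transcendental_iff_injective.1 hz h3)
    rw [hgz, h4, map_one, one_mul]
  rw [mem_bot] at hzmem
  obtain ⟨e, he⟩ := hzmem
  have hzE' : z ∈ E := by
    rw [← he]
    exact e.2
  rw [← top_le_iff, ← hgen, adjoin_le_iff, Set.insert_subset_iff, Set.singleton_subset_iff]
  exact ⟨hzE', hwE⟩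

end Galois

end GaloisPoints

end

/-! ### The norm form at the points `(0 : 1 : 0)` and `(0 : 0 : 1)` -/

noncomputable section

open MvPolynomial

namespace GaloisPoints

section NormFormCoeff

variable {K : Type*} [Field K]

theorem homogenize_eq_sum (P : Polynomial K) (d : ℕ) :
    P.homogenize d =
      ∑ kl ∈ Finset.HasAntidiagonal.antidiagonal d, C (P.coeff kl.1) * (X 0 ^ kl.1 * X 1 ^ kl.2) := by
  rw [Polynomial.homogenize]
  refine Finset.sum_congr rfl fun kl _ => ?_
  rw [Finsupp.update_eq_add_single (by simp), monomial_eq]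
  simp [Finsupp.prod_add_index', pow_add]

theorem eval_homogenize_zero_one (P : Polynomial K) (d : ℕ) :
    eval ![0, 1] (P.homogenize d) = P.coeff 0 := by
  rw [homogenize_eq_sum, map_sum, Finset.sum_eq_single_of_mem (0, d) (by simp)]
  · simp
  · rintro ⟨k, l⟩ hkl hne
    rw [Finset.HasAntidiagonal.mem_antidiagonal] at hkl
    have hk : k ≠ 0 := by
      rintro rfl
      exact hne (by rw [← hkl, zero_add])
    simp [hk]

theorem eval_homogenize_one_zero (P : Polynomial K) (d : ℕ) :
    eval ![1, 0] (P.homogenize d) = P.coeff d := by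
  rw [homogenize_eq_sum, map_sum, Finset.sum_eq_single_of_mem (d, 0) (by simp)]
  · simp
  · rintro ⟨k, l⟩ hkl hne
    rw [Finset.HasAntidiagonal.mem_antidiagonal] at hkl
    have hl : l ≠ 0 := by
      rintro rfl
      exact hne (by rw [← hkl, add_zero])
    simp [hl]

theorem eval_pderiv_homogenize_zero_one (P : Polynomial K) {d : ℕ} (hd : 0 < d) :
    eval ![0, 1] (pderiv 0 (P.homogenize d)) = P.coeff 1 := by
  rw [homogenize_eq_sum, map_sum, map_sum,
    Finset.sum_eq_single_of_mem (1, d - 1) (by simp; omega)]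
  · simp
  · rintro ⟨k, l⟩ hkl hne
    rw [Finset.HasAntidiagonal.mem_antidiagonal] at hkl
    have hk : k ≠ 1 := by
      rintro rfl
      exact hne (by rw [← hkl]; simp)
    rcases k with _ | _ | k
    · simp
    · exact absurd rfl hk
    · simp

theorem eval_pderiv_homogenize_one_zero (P : Polynomial K) {d : ℕ} (hd : 0 < d) :
    eval ![1, 0] (pderiv 1 (P.homogenize d)) = P.coeff (d - 1) := by
  rw [homogenize_eq_sum, map_sum, map_sum,
    Finset.sum_eq_single_of_mem (d - 1, 1) (by simp; omega)]
  · simp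
  · rintro ⟨k, l⟩ hkl hne
    rw [Finset.HasAntidiagonal.mem_antidiagonal] at hkl
    have hl : l ≠ 1 := by
      rintro rfl
      exact hne (by rw [← hkl]; simp)
    rcases l with _ | _ | l
    · simp
    · exact absurd rfl hl
    · simp

/-- The coordinate points of the plane. -/
def coordPoint (K : Type*) [Field K] (i : Fin 3) : Plane K :=
  Projectivization.mk K (Pi.single i 1) (by simp)

theorem coordPoint_injective : Function.Injective (coordPoint K) := by
  intro i j h
  rw [coordPoint, coordPoint, Projectivization.mk_eq_mk_iff'] at h
  obtain ⟨a, ha⟩ := h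
  by_contra hij
  have := congrFun ha i
  simp [Pi.single_eq_of_ne hij] at this

theorem eval_rep_coordPoint_eq_zero_iff (i : Fin 3) {d : ℕ} {P : MvPolynomial (Fin 3) K}
    (hP : P.IsHomogeneous d) :
    eval (coordPoint K i).rep P = 0 ↔ eval (Pi.single i 1) P = 0 := by
  obtain ⟨a, ha0, ha⟩ := PlaneCurve.exists_rep_mk (Pi.single i (1 : K)) (by simp)
  rw [coordPoint, ha d P hP, mul_eq_zero, or_iff_right (pow_ne_zero _ ha0)]

/-- The constant term of the norm is `∏ (-T(ζ Z))`, and contraction turns `Z ^ (k * N)` into degree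
`k`. -/
theorem coeff_contract_coeff_zero_twistProd {N : ℕ} (hN : N ≠ 0) (T : Polynomial K) (k : ℕ) :
    (((twistProd N T).coeff 0).contract N).coeff k =
      (∏ ζ ∈ Polynomial.nthRootsFinset N (1 : K), -twist ζ T).coeff (k * N) := by
  rw [Polynomial.coeff_contract hN, Polynomial.coeff_zero_eq_eval_zero, twistProd,
    Polynomial.eval_prod]
  simp

theorem pderiv_succ_normForm_eq (m N : ℕ) (T : Polynomial K) (i : Fin 2) (c : Fin 3 → K)
    (hc : c 0 = 0) (hm : 0 < m) :
    eval c (pderiv i.succ (normForm m N T)) = eval (fun i => c (Fin.succ i))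
      (pderiv i ((((twistProd N T).coeff 0).contract N).homogenize (m * N))) := by
  rw [normForm, map_sum, map_sum, Finset.sum_eq_single_of_mem 0 (by simp)]
  · rw [mul_zero, pow_zero, one_mul, pderiv_rename (Fin.succ_injective 2), eval_rename, Nat.sub_zero]
    rfl
  · intro j _ hj
    simp [Derivation.leibniz_pow, pderiv_X_of_ne (Fin.succ_ne_zero i).symm, hc, hm.ne', hj]

theorem nthRootsFinset_one_ne_zero {N : ℕ} (hN : 0 < N) {ζ : K}
    (hζ : ζ ∈ Polynomial.nthRootsFinset N (1 : K)) : ζ ≠ 0 := by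
  rintro rfl
  rw [Polynomial.mem_nthRootsFinset hN, zero_pow hN.ne'] at hζ
  exact zero_ne_one hζ

theorem coeff_zero_prod_neg_twist {N : ℕ} (hN0 : 0 < N) {T : Polynomial K} :
    (∏ ζ ∈ Polynomial.nthRootsFinset N (1 : K), -twist ζ T).coeff 0 = 0 ↔ T.coeff 0 = 0 := by
  rw [Polynomial.coeff_zero_prod, Finset.prod_eq_zero_iff]
  simp only [Polynomial.coeff_neg, coeff_twist, neg_eq_zero, pow_zero, mul_one]
  exact ⟨fun ⟨_, _, h⟩ => h, fun h => ⟨1, by simp [Polynomial.mem_nthRootsFinset hN0], h⟩⟩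

theorem eval_coordPoint_two_normForm {m N : ℕ} {T : Polynomial K} (hm : 0 < m)
    (hN0 : 0 < N) :
    eval (coordPoint K 2).rep (normForm m N T) = 0 ↔ T.coeff 0 = 0 := by
  rw [eval_rep_coordPoint_eq_zero_iff 2 (normForm_isHomogeneous m N T),
    eval_normForm_of_eq_zero m T _ (by simp) hm,
    show (fun i : Fin 2 => (Pi.single 2 1 : Fin 3 → K) i.succ) = ![0, 1] by
      funext i; fin_cases i <;> rfl, eval_homogenize_zero_one,
    coeff_contract_coeff_zero_twistProd hN0.ne', zero_mul, coeff_zero_prod_neg_twist hN0]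

variable [IsAlgClosed K]

/-- In this top degree the coefficient is the product of the `-(T.coeff d) * ζ ^ d`, and no `ζ` is
zero. -/
theorem coeff_prod_neg_twist {N d : ℕ} (hN : (N : K) ≠ 0) {T : Polynomial K}
    (hT : T.natDegree ≤ d) :
    (∏ ζ ∈ Polynomial.nthRootsFinset N (1 : K), -twist ζ T).coeff (d * N) = 0 ↔
      T.coeff d = 0 := by
  have hN0 : 0 < N := Nat.pos_of_ne_zero fun h => hN (by rw [h, Nat.cast_zero])
  have h := Polynomial.coeff_prod_of_natDegree_le (Polynomial.nthRootsFinset N (1 : K))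
    (fun ζ => -twist ζ T) d (fun ζ _ => by
      rw [Polynomial.natDegree_neg]
      exact (natDegree_twist_le ζ T).trans hT)
  rw [card_nthRootsFinset_one hN, mul_comm N d] at h
  rw [h, Finset.prod_eq_zero_iff]
  simp only [Polynomial.coeff_neg, coeff_twist, neg_eq_zero, mul_eq_zero]
  constructor
  · rintro ⟨ζ, hζ, h0 | h0⟩
    · exact h0
    · exact absurd h0 (pow_ne_zero d (nthRootsFinset_one_ne_zero hN0 hζ))
  · intro h0
    exact ⟨1, by simp [Polynomial.mem_nthRootsFinset hN0], Or.inl h0⟩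

/-- Each of the `N` factors has a simple zero at the origin, so the product vanishes there to order
exactly `N`. -/
theorem coeff_card_prod_neg_twist_ne_zero {N : ℕ} (hN : (N : K) ≠ 0) {T : Polynomial K}
    (hT0 : T.coeff 0 = 0) (hT1 : T.coeff 1 ≠ 0) :
    (∏ ζ ∈ Polynomial.nthRootsFinset N (1 : K), -twist ζ T).coeff N ≠ 0 := by
  have hN0 : 0 < N := Nat.pos_of_ne_zero fun h => hN (by rw [h, Nat.cast_zero])
  obtain ⟨S, rfl⟩ := Polynomial.X_dvd_iff.2 hT0
  have hS : S.coeff 0 ≠ 0 := by simpa using hT1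
  have h1 : ∀ ζ : K, -twist ζ (Polynomial.X * S) =
      Polynomial.X * (-(Polynomial.C ζ * twist ζ S)) := by
    intro ζ
    have : twist ζ Polynomial.X = Polynomial.C ζ * Polynomial.X := by simp [twist]
    rw [map_mul, this]
    ring
  rw [Finset.prod_congr rfl fun ζ _ => h1 ζ, Finset.prod_mul_distrib, Finset.prod_const,
    card_nthRootsFinset_one hN]
  have h2 := Polynomial.coeff_X_pow_mul
    (∏ ζ ∈ Polynomial.nthRootsFinset N (1 : K), -(Polynomial.C ζ * twist ζ S)) N 0
  rw [zero_add] at h2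
  rw [h2, Polynomial.coeff_zero_prod, Finset.prod_ne_zero_iff]
  intro ζ hζ
  rw [Polynomial.coeff_neg, Polynomial.coeff_C_mul, coeff_twist, pow_zero, mul_one, neg_ne_zero]
  exact mul_ne_zero (nthRootsFinset_one_ne_zero hN0 hζ) hS

variable {m N : ℕ} {T : Polynomial K}

theorem eval_coordPoint_one_normForm (hm : 0 < m) (hN : (N : K) ≠ 0) (hT : T.natDegree ≤ m * N) :
    eval (coordPoint K 1).rep (normForm m N T) = 0 ↔ T.coeff (m * N) = 0 := by
  have hN0 : N ≠ 0 := fun h => hN (by rw [h, Nat.cast_zero])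
  rw [eval_rep_coordPoint_eq_zero_iff 1 (normForm_isHomogeneous m N T),
    eval_normForm_of_eq_zero m T _ (by simp) hm,
    show (fun i : Fin 2 => (Pi.single 1 1 : Fin 3 → K) i.succ) = ![1, 0] by
      funext i; fin_cases i <;> rfl, eval_homogenize_one_zero,
    coeff_contract_coeff_zero_twistProd hN0, coeff_prod_neg_twist hN hT]

/-- At `(0 : 1 : 0)` this derivative is, up to a nonzero scalar, the coefficient of `X 1 ^ (m * N -
1) * X 2`, a product of top coefficients of the factors. -/
theorem eval_coordPoint_one_pderiv_normForm (hm : 0 < m) (hN : (N : K) ≠ 0)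
    (hT : T.natDegree ≤ m * N - 1) (hT1 : T.coeff (m * N - 1) ≠ 0) :
    eval (coordPoint K 1).rep (pderiv 2 (normForm m N T)) ≠ 0 := by
  have hN0 : N ≠ 0 := fun h => hN (by rw [h, Nat.cast_zero])
  rw [Ne, eval_rep_coordPoint_eq_zero_iff 1 (normForm_isHomogeneous m N T).pderiv,
    show (2 : Fin 3) = Fin.succ 1 from rfl,
    pderiv_succ_normForm_eq m N T 1 _ (by simp) hm,
    show (fun i : Fin 2 => (Pi.single 1 1 : Fin 3 → K) i.succ) = ![1, 0] by
      funext i; fin_cases i <;> rfl,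
    eval_pderiv_homogenize_one_zero _ (Nat.mul_pos hm (Nat.pos_of_ne_zero hN0)),
    coeff_contract_coeff_zero_twistProd hN0, coeff_prod_neg_twist hN hT]
  exact hT1

/-- At `(0 : 0 : 1)` this derivative is, up to a nonzero scalar, the coefficient of `X 1 * X 2 ^ (m
* N - 1)`, that is, of `Z ^ N` in `∏ (-T(ζ Z))`. -/
theorem eval_coordPoint_two_pderiv_normForm (hm : 0 < m) (hN : (N : K) ≠ 0)
    (hT0 : T.coeff 0 = 0) (hT1 : T.coeff 1 ≠ 0) :
    eval (coordPoint K 2).rep (pderiv 1 (normForm m N T)) ≠ 0 := by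
  have hN0 : N ≠ 0 := fun h => hN (by rw [h, Nat.cast_zero])
  rw [Ne, eval_rep_coordPoint_eq_zero_iff 2 (normForm_isHomogeneous m N T).pderiv,
    show (1 : Fin 3) = Fin.succ 0 from rfl,
    pderiv_succ_normForm_eq m N T 0 _ (by simp) hm,
    show (fun i : Fin 2 => (Pi.single 2 1 : Fin 3 → K) i.succ) = ![0, 1] by
      funext i; fin_cases i <;> rfl,
    eval_pderiv_homogenize_zero_one _ (Nat.mul_pos hm (Nat.pos_of_ne_zero hN0)),
    coeff_contract_coeff_zero_twistProd hN0, one_mul]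
  exact coeff_card_prod_neg_twist_ne_zero hN hT0 hT1

end NormFormCoeff

end GaloisPoints

end

/-! ### The plane model and its two Galois points -/

noncomputable section

open MvPolynomial

namespace GaloisPoints

section PlaneModel

variable {K : Type*} [Field K] [IsAlgClosed K]

open IntermediateField

/-- The plane model of a curve `w ^ m = T(z)` given by the functions `(w : z ^ N : 1)`. -/
theorem exists_plane_model {C : PlaneCurve K}
    (hres : ∀ (R : C.SmoothModel) (g : C.FunctionField), g ∈ R.1 →
      ∃ c, PlaneCurve.SmoothModel.HasValueAt g R c)
    (hfin : ∀ g : C.FunctionField, {R : C.SmoothModel | g ∉ R.1}.Finite)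
    {m N : ℕ} (hm : 0 < m) (hN : (N : K) ≠ 0) {T : Polynomial K} (hTd : T.natDegree ≤ m * N)
    {a : K} (ha : T.eval a = 0) (ha' : (Polynomial.derivative T).eval a ≠ 0)
    (hT : ∀ ζ : K, ζ ^ N = 1 → twist ζ T = T → ζ = 1) {z w : C.FunctionField}
    (hz : Transcendental K z) (hw : w ^ m = Polynomial.aeval z T)
    (hgen : adjoin K {z, w} = ⊤) (hg₁ : IsGalois K⟮w⟯ C.FunctionField)
    (hg₂ : IsGalois K⟮w / z ^ N⟯ C.FunctionField) :
    ∃ φ : C.SmoothModel → Plane K, PlaneCurve.SmoothModel.IsMorphism φ ∧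
      ∃ D : PlaneCurve K, PlaneCurve.SmoothModel.IsBirationalOnto φ D ∧
        D.poly = normForm m N T ∧ D.degree = m * N ∧
        D.IsGaloisPoint (coordPoint K 1) ∧ D.IsGaloisPoint (coordPoint K 2) := by
  have hN0 : 0 < N := Nat.pos_of_ne_zero fun h => hN (by rw [h, Nat.cast_zero])
  have hz0 : z ≠ 0 := by
    rintro rfl
    exact hz isAlgebraic_zero
  have hw0 : w ≠ 0 := by
    rintro rfl
    rw [zero_pow hm.ne', eq_comm, ← map_zero (Polynomial.aeval z : Polynomial K →ₐ[K] _)] at hw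
    rw [transcendental_iff_injective.1 hz hw] at ha'
    simp at ha'
  have hG0 : aeval ![w, z ^ N, 1] (normForm m N T) = 0 := by
    rw [aeval_normForm hN hTd]
    refine Finset.prod_eq_zero (i := 1) (by simp [Polynomial.mem_nthRootsFinset hN0]) ?_
    rw [map_one, one_mul, hw, sub_self]
  obtain ⟨hmon, hdeg⟩ := monic_finSuccEquiv_normForm hm hN T
  have hcone := coneEval_eq_zero_iff_dvd (Nat.mul_pos hm hN0)
    (fun A hA hA0 => eq_zero_of_eval₂_pow_eq_zero hm hN ha ha' hT hz hw hA hA0)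
    (normForm_isHomogeneous m N T) hmon hdeg hG0
  have hne : normForm m N T ≠ 0 := by
    intro h
    rw [h, map_zero] at hmon
    exact hmon.ne_zero rfl
  have htd : (normForm m N T).totalDegree = m * N :=
    (normForm_isHomogeneous m N T).totalDegree hne
  let D : PlaneCurve K :=
    { poly := normForm m N T
      isHomogeneous := by
        rw [htd]
        exact normForm_isHomogeneous m N T
      irreducible := irreducible_of_coneEval_eq_zero_iff_dvd hne hcone }
  have hker : ∀ (n : ℕ) (P : MvPolynomial (Fin 3) K), P.IsHomogeneous n →
      (aeval ![w, z ^ N, 1] P = 0 ↔ D.poly ∣ P) := by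
    intro n P hP
    rw [← hcone, coneEval_of_isHomogeneous _ hP, mul_eq_zero,
      or_iff_right (pow_ne_zero n Polynomial.X_ne_zero), Polynomial.C_eq_zero]
  have hf0 : ∀ i, (![w, z ^ N, 1] : Fin 3 → C.FunctionField) i ≠ 0 := by
    intro i
    fin_cases i
    · exact hw0
    · exact pow_ne_zero N hz0
    · exact one_ne_zero
  have hcoord : ∀ i, D.coord (X i) ≠ 0 := by
    intro i h
    have h1 := (hker 1 (X i) (isHomogeneous_X _ _)).2 ((D.coord_eq_zero_iff _).1 h)
    rw [aeval_X] at h1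
    exact hf0 i h1
  obtain ⟨σ, hσ⟩ := D.exists_algEquiv_functionField ![w, z ^ N, 1] hker (by
    refine adjoin_pow_eq_top hN0 hT hz hw hgen ?_ ?_
    · exact subset_adjoin _ _ ⟨0, 2, by simp⟩
    · exact subset_adjoin _ _ ⟨1, 2, by simp⟩)
  obtain ⟨φ, hφ, hbir⟩ := PlaneCurve.exists_isMorphism_isBirationalOnto hres hfin ![w, z ^ N, 1]
    hf0 ⟨1, 2, fun c hc => by
      refine hz.pow hN0 ?_
      have : z ^ N = algebraMap K C.FunctionField c := by simpa using hc
      rw [this]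
      exact isAlgebraic_algebraMap c⟩ hker σ hσ
  -- The forms `X i` and `X j` vanish at the `k`-th coordinate point, so the projection field
  -- contains the copy of `K(g)`. The Galois property passes to this larger base, so equality of the
  -- two fields need not be shown.
  have hgal : ∀ (i j k : Fin 3) (g : C.FunctionField),
      (![w, z ^ N, 1] : Fin 3 → C.FunctionField) i / ![w, z ^ N, 1] j = g → i ≠ k → j ≠ k →
      IsGalois K⟮g⟯ C.FunctionField → D.IsGaloisPoint (coordPoint K k) := by
    intro i j k g hg hik hjk h
    have h1 := isGalois_adjoin_simple_map σ.symm (w := g)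
    refine isGalois_of_le (S := K⟮σ.symm g⟯) ?_
    rw [adjoin_simple_le_iff]
    refine subset_adjoin _ _ ⟨X i, X j, isHomogeneous_X _ _, isHomogeneous_X _ _, ?_, ?_,
      hcoord j, ?_⟩
    · rw [eval_rep_coordPoint_eq_zero_iff k (isHomogeneous_X _ _)]
      simp [hik]
    · rw [eval_rep_coordPoint_eq_zero_iff k (isHomogeneous_X _ _)]
      simp [hjk]
    · have h2 : σ.symm g = D.fracForm (isHomogeneous_X _ i) (isHomogeneous_X _ j) (hcoord j) := by
        rw [AlgEquiv.symm_apply_eq, hσ _ 1 (X i) (X j) (isHomogeneous_X _ _) (isHomogeneous_X _ _)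
          (hcoord j) rfl, aeval_X, aeval_X, hg]
      rw [h2]
      rfl
  refine ⟨φ, hφ, D, hbir, rfl, htd, ?_, ?_⟩
  · exact hgal 0 2 1 w (by simp) (by decide) (by decide) hg₁
  · exact hgal 0 1 2 (w / z ^ N) (by simp) (by decide) (by decide) hg₂

end PlaneModel

/-! ### Affine generators of the function field of `y ^ m = x ^ q + x` -/

section FunctionField

variable {K : Type*} [Field K]

open IntermediateField

theorem coe_aeval_intermediateField {L ι : Type*} [Field L] [Algebra K L]
    (E : IntermediateField K L) (f : ι → E) (P : MvPolynomial ι K) :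
    ((aeval f P : E) : L) = aeval (fun i => (f i : L)) P :=
  (aeval_algebraMap_apply L f P).symm

theorem div_pow_eq_of_homogeneous {L : Type*} [Field L] {a b c : L} {m q : ℕ} (hmq : m < q)
    (hc : c ≠ 0) (h : b ^ m * c ^ (q - m) = a ^ q + a * c ^ (q - 1)) :
    (b / c) ^ m = (a / c) ^ q + a / c := by
  have h1 : c ^ q = c ^ m * c ^ (q - m) := by rw [← pow_add]; congr 1; omega
  have h2 : c ^ q = c * c ^ (q - 1) := by rw [← pow_succ']; congr 1; omega
  have h3 : (b / c) ^ m = b ^ m * c ^ (q - m) / c ^ q := by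
    rw [h1, div_pow, mul_div_mul_right _ _ (pow_ne_zero _ hc)]
  rw [h3, h, add_div, div_pow]
  congr 1
  rw [h2, mul_div_mul_right _ _ (pow_ne_zero _ hc)]

/-- The affine coordinates generate the function field. -/
theorem adjoin_affine_coordinates_eq_top (C : PlaneCurve K) (h2 : C.coord (X 2) ≠ 0) :
    adjoin K {C.fracForm (isHomogeneous_X K 0) (isHomogeneous_X K 2) h2,
      C.fracForm (isHomogeneous_X K 1) (isHomogeneous_X K 2) h2} = ⊤ := by
  set x := C.fracForm (isHomogeneous_X K 0) (isHomogeneous_X K 2) h2 with hx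
  set y := C.fracForm (isHomogeneous_X K 1) (isHomogeneous_X K 2) h2 with hy
  have hf : ∀ (n : ℕ) (P : MvPolynomial (Fin 3) K), P.IsHomogeneous n →
      C.coord P = C.coord (X 2) ^ n * (aeval ![x, y, 1] P : C.FunctionField) := by
    intro n P hP
    have h1 : (aeval ![x, y, 1] P : C.FunctionField) =
        aeval (fun i => ((![x, y, 1] : Fin 3 → C.FunctionField) i :
          FractionRing C.CoordinateRing)) P :=
      coe_aeval_intermediateField _ _ P
    rw [h1, ← aeval_mul_left_of_isHomogeneous hP]
    have h2' : C.coord = aeval fun i => C.coord (X i) := by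
      ext i
      simp
    conv_lhs => rw [h2']
    congr 2
    funext i
    fin_cases i
    · change C.coord (X 0) = C.coord (X 2) * (C.coord (X 0) / C.coord (X 2))
      rw [mul_div_cancel₀ _ h2]
    · change C.coord (X 1) = C.coord (X 2) * (C.coord (X 1) / C.coord (X 2))
      rw [mul_div_cancel₀ _ h2]
    · change C.coord (X 2) = C.coord (X 2) * 1
      rw [mul_one]
  have hmem : ∀ P : MvPolynomial (Fin 3) K, aeval ![x, y, 1] P ∈ adjoin K {x, y} := by
    intro P
    induction P using MvPolynomial.induction_on with
    | C a => simp
    | add P Q hP hQ => simpa using add_mem hP hQ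
    | mul_X P i hP =>
      rw [map_mul, aeval_X]
      refine mul_mem hP ?_
      fin_cases i
      · exact subset_adjoin _ _ (by simp)
      · exact subset_adjoin _ _ (by simp)
      · exact one_mem _
  rw [← top_le_iff]
  rintro ⟨_, n, A, B, hA, hB, hB0, rfl⟩ -
  have h : (⟨C.coord A / C.coord B, n, A, B, hA, hB, hB0, rfl⟩ : C.FunctionField) =
      aeval ![x, y, 1] A / aeval ![x, y, 1] B := by
    apply Subtype.ext
    change C.coord A / C.coord B =
      (aeval ![x, y, 1] A : C.FunctionField) / (aeval ![x, y, 1] B : C.FunctionField)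
    rw [hf n A hA, hf n B hB, mul_div_mul_left _ _ (pow_ne_zero n h2)]
  rw [h]
  exact div_mem (hmem A) (hmem B)

/-- Rational functions `x` and `y` generating the function field of the curve
`y ^ m = x ^ q + x`. -/
theorem exists_generators_artinSchreierCurve [IsAlgClosed K] {q m : ℕ} (hm : 2 ≤ m) (hmq : m < q) :
    ∃ x y : (artinSchreierCurve K q m hm hmq).FunctionField, Transcendental K x ∧
      y ^ m = x ^ q + x ∧ adjoin K {x, y} = ⊤ := by
  set C := artinSchreierCurve K q m hm hmq with hC
  have hpoly : C.poly = artinSchreierPoly K q m := rfl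
  -- The curve has degree `q > 1`, so its equation divides no nonzero linear form. If `x` were
  -- algebraic, it would be a constant `c`, and `X 0 - c * X 2` would contradict this.
  have hlin : ∀ l : MvPolynomial (Fin 3) K, l.IsHomogeneous 1 → l ≠ 0 → C.coord l ≠ 0 := by
    intro l hl hl0 h
    obtain ⟨P, hP⟩ := (C.coord_eq_zero_iff l).1 h
    have hP0 : P ≠ 0 := by
      rintro rfl
      exact hl0 (by rw [hP, mul_zero])
    have h1 := totalDegree_mul_of_isDomain C.irreducible.ne_zero hP0
    rw [← hP, hl.totalDegree hl0, hpoly,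
      (artinSchreierPoly_isHomogeneous K hmq).totalDegree
        (artinSchreierPoly_irreducible K hm hmq).ne_zero] at h1
    omega
  have h2 : C.coord (X 2) ≠ 0 := hlin _ (isHomogeneous_X _ _) (X_ne_zero _)
  refine ⟨C.fracForm (isHomogeneous_X K 0) (isHomogeneous_X K 2) h2,
    C.fracForm (isHomogeneous_X K 1) (isHomogeneous_X K 2) h2, ?_, ?_,
    adjoin_affine_coordinates_eq_top C h2⟩
  · intro halg
    obtain ⟨c, hc⟩ := minpoly.mem_range_of_degree_eq_one K _
      (IsAlgClosed.degree_eq_one_of_irreducible K (minpoly.irreducible halg.isIntegral))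
    have h1 : algebraMap K (FractionRing C.CoordinateRing) c = C.coord (X 0) / C.coord (X 2) :=
      congrArg Subtype.val hc
    rw [eq_div_iff h2] at h1
    refine hlin (X 0 - MvPolynomial.C c * X 2)
      ((isHomogeneous_X _ _).sub (isHomogeneous_C_mul_X _ _)) ?_ ?_
    · intro h0
      have := congrArg (eval (Pi.single 0 1)) h0
      simp at this
    · rw [map_sub, map_mul, ← h1, sub_eq_zero]
      congr 1
  · apply Subtype.ext
    change (C.coord (X 1) / C.coord (X 2)) ^ m =
      (C.coord (X 0) / C.coord (X 2)) ^ q + C.coord (X 0) / C.coord (X 2)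
    have h0 : C.coord (artinSchreierPoly K q m) = 0 := (C.coord_eq_zero_iff _).2 dvd_rfl
    simp only [artinSchreierPoly, map_sub, map_add, map_mul, map_pow] at h0
    exact div_pow_eq_of_homogeneous hmq h2 (sub_eq_zero.1 h0)

end FunctionField

end GaloisPoints

end

/-! ### The two choices of `T` and the conclusion -/

noncomputable section

namespace GaloisPoints

section Final

variable {K : Type*} [Field K]

open IntermediateField Polynomial

theorem eq_top_of_generators_mem {L : Type*} [Field L] [Algebra K L] {z w : L}
    (h : adjoin K {z, w} = ⊤) {E : IntermediateField K L} (hz : z ∈ E) (hw : w ∈ E) : E = ⊤ := by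
  rw [← top_le_iff, ← h, adjoin_le_iff, Set.insert_subset_iff, Set.singleton_subset_iff]
  exact ⟨hz, hw⟩

section Polynomials

variable {p n q : ℕ}

/-- The polynomial `(X - 1) ^ (q + 1) + (c - 1)`, expanded in characteristic dividing `q`. -/
def shiftedFermat (q : ℕ) (c : K) : K[X] := X ^ (q + 1) - X ^ q - X + Polynomial.C c

theorem coeff_shiftedFermat (hq2 : 2 < q) (c : K) :
    (shiftedFermat q c).coeff (q + 1) = 1 ∧ (shiftedFermat q c).coeff 1 = -1 ∧
      (shiftedFermat q c).coeff 0 = c := by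
  refine ⟨?_, ?_, ?_⟩
  · simp [shiftedFermat, coeff_X_pow, coeff_X, show q ≠ 0 by omega]
  · simp [shiftedFermat, coeff_X_pow, show (1 : ℕ) ≠ q by omega, show q ≠ 0 by omega]
  · simp [shiftedFermat, coeff_X_pow, show (0 : ℕ) ≠ q by omega]

theorem natDegree_shiftedFermat_le (hq2 : 2 < q) (c : K) :
    (shiftedFermat q c).natDegree ≤ q + 1 := by
  rw [natDegree_le_iff_coeff_eq_zero]
  intro k hk
  simp [shiftedFermat, coeff_X_pow, coeff_X, coeff_C, show k ≠ q + 1 by omega,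
    show k ≠ q by omega, show 1 ≠ k by omega, show k ≠ 0 by omega]

theorem aeval_shiftedFermat {L : Type*} [Field L] [Algebra K L] (c : K) (z : L) :
    aeval z (shiftedFermat q c) = z ^ (q + 1) - z ^ q - z + algebraMap K L c := by
  simp [shiftedFermat]

section Char

variable [Fact p.Prime]

/-- In characteristic `p`, the form `x ^ q + x` in other coordinates. -/
theorem pow_add_eq_of_char {L : Type*} [Field L] [CharP L p] (hq : q = p ^ n)
    {x d r c μ s : L} (hd0 : d ≠ 0) (hd : d ^ (q + 1) = 1 - c) (hr : r = 1 + d)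
    (hμ : μ ^ q + μ = -1) (hs : s = (x + μ) / d) (hs0 : s ≠ 0) :
    x ^ q + x = s ^ (q + 1) *
      ((r + s⁻¹) ^ (q + 1) - (r + s⁻¹) ^ q - (r + s⁻¹) + c) := by
  have hx : x = d * s - μ := by
    rw [hs, mul_div_cancel₀ _ hd0]
    ring
  have h1 : x ^ q = d ^ q * s ^ q - μ ^ q := by
    rw [hx, ← mul_pow]
    subst hq
    exact sub_pow_char_pow (d * s) μ n
  have h2 : (r + s⁻¹) ^ q = 1 + d ^ q + s⁻¹ ^ q := by
    subst hq
    rw [add_pow_char_pow, hr, add_pow_char_pow, one_pow]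
  have hc : c = 1 - d ^ q * d := by
    rw [← pow_succ, hd]
    ring
  have hsq : s ^ q * s⁻¹ ^ q = 1 := by
    rw [← mul_pow, mul_inv_cancel₀ hs0, one_pow]
  have hs1 : s * s⁻¹ = 1 := mul_inv_cancel₀ hs0
  -- Both sides equal `(d * s) ^ q + d * s + 1`; treating the `q`-th powers as independent variables
  -- reduces this to a linear combination of the hypotheses.
  rw [h1, pow_succ, pow_succ (r + s⁻¹), h2, hr, hc]
  generalize s⁻¹ ^ q = tq at *
  generalize s⁻¹ = t at *
  generalize s ^ q = sq at *
  rw [hx]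
  linear_combination (-1 : L) * hμ - d * s * hsq
    - d ^ q * sq * hs1 - sq * tq * hs1 - hsq

variable [CharP K p]

theorem eval_shiftedFermat (hq : q = p ^ n) {c d : K} (hd : d ^ (q + 1) = 1 - c) :
    (shiftedFermat q c).eval (1 + d) = 0 := by
  have h1 : (1 + d) ^ q = 1 + d ^ q := by rw [hq, add_pow_char_pow, one_pow]
  simp only [shiftedFermat, eval_add, eval_sub, eval_pow, eval_X, eval_C]
  rw [pow_succ, h1]
  linear_combination hd

theorem eval_derivative_shiftedFermat (hn : 0 < n) (hq : q = p ^ n) (c d : K) :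
    (derivative (shiftedFermat q c)).eval (1 + d) = d ^ q := by
  have h1 : (1 + d) ^ q = 1 + d ^ q := by rw [hq, add_pow_char_pow, one_pow]
  have hqK : (q : K) = 0 := by
    rw [hq, Nat.cast_pow, CharP.cast_eq_zero, zero_pow hn.ne']
  simp only [shiftedFermat, derivative_sub, derivative_X_pow, derivative_X,
    derivative_C, eval_add, eval_sub, eval_mul, eval_pow, eval_X, eval_one, eval_zero,
    Nat.cast_add, Nat.cast_one, hqK, Nat.add_sub_cancel, h1, map_add, map_zero, map_one]
  ring

end Char

variable [IsAlgClosed K]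

/-- A primitive `(q - 1)`-th root of unity serves; it differs from `1` because `q > 2`. -/
theorem exists_pow_eq_self_ne [CharP K p] (hn : 0 < n) (hq : q = p ^ n) (hq2 : 2 < q) :
    ∃ c : K, c ^ q = c ∧ c ≠ 0 ∧ c ≠ 1 := by
  have hq0 : (q : K) = 0 := by
    rw [hq, Nat.cast_pow, CharP.cast_eq_zero, zero_pow hn.ne']
  have : NeZero ((q - 1 : ℕ) : K) := ⟨by
    rw [Nat.cast_sub (by omega), hq0]
    simp⟩
  obtain ⟨c, hc⟩ := HasEnoughRootsOfUnity.exists_primitiveRoot K (q - 1)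
  refine ⟨c, ?_, hc.ne_zero (by omega), hc.ne_one (by omega)⟩
  conv_lhs => rw [← Nat.sub_add_cancel (show 1 ≤ q by omega), pow_succ, hc.pow_eq_one, one_mul]

variable [Fact p.Prime] [CharP K p]

/-- The model `y ^ m = x ^ q + x` of the curve, with the functions `x` and `y`, leads to
two inner Galois points. -/
theorem exists_plane_model_inner {C : PlaneCurve K}
    (hres : ∀ (R : C.SmoothModel) (g : C.FunctionField), g ∈ R.1 →
      ∃ c, PlaneCurve.SmoothModel.HasValueAt g R c)
    (hfin : ∀ g : C.FunctionField, {R : C.SmoothModel | g ∉ R.1}.Finite)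
    (hn : 0 < n) (hq : q = p ^ n) (hq2 : 2 ≤ q) {m N : ℕ} (hm : 0 < m) (hN : (N : K) ≠ 0)
    (hmN : m * N = q + 1) {x y : C.FunctionField} (hx : Transcendental K x)
    (hxy : y ^ m = x ^ q + x) (hgen : adjoin K {x, y} = ⊤) :
    ∃ φ : C.SmoothModel → Plane K, PlaneCurve.SmoothModel.IsMorphism φ ∧
      ∃ D : PlaneCurve K, PlaneCurve.SmoothModel.IsBirationalOnto φ D ∧ D.degree = q + 1 ∧
        ∃ P₁ P₂ : Plane K, P₁ ≠ P₂ ∧ D.IsInnerGaloisPoint P₁ ∧ D.IsInnerGaloisPoint P₂ := by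
  have hN0 : 0 < N := Nat.pos_of_ne_zero fun h => hN (by rw [h, Nat.cast_zero])
  have hx0 : x ≠ 0 := by
    rintro rfl
    exact hx isAlgebraic_zero
  set T : K[X] := X ^ q + X with hT
  have hTq : T.coeff q = 1 := by simp [hT, coeff_X, show (1 : ℕ) ≠ q by omega]
  have hT1 : T.coeff 1 = 1 := by simp [hT, coeff_X_pow, show (1 : ℕ) ≠ q by omega]
  have hT0 : T.coeff 0 = 0 := by simp [hT, coeff_X_pow, show (0 : ℕ) ≠ q by omega]
  have hTq1 : T.coeff (q + 1) = 0 := by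
    simp [hT, coeff_X_pow, coeff_X, show q ≠ 0 by omega]
  have hTd : T.natDegree ≤ q := by
    refine (natDegree_add_le _ _).trans (max_le (natDegree_X_pow_le q) ?_)
    rw [natDegree_X]
    omega
  -- As `m * N = q + 1`, replacing `(x, y)` by `(x⁻¹, y / x ^ N)` preserves the equation, so the
  -- second projection is handled like the first.
  have hw' : (y / x ^ N) ^ m = x⁻¹ ^ q + x⁻¹ := by
    rw [div_pow, ← pow_mul, mul_comm N m, hmN, hxy, inv_pow, pow_succ]
    have hxq : x ^ q ≠ 0 := pow_ne_zero q hx0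
    generalize x ^ q = xq at *
    field_simp
    ring
  obtain ⟨φ, hφ, D, hbir, hpoly, hdeg, hg₁, hg₂⟩ := exists_plane_model (N := N) (T := T) (a := 0)
    hres hfin hm hN (hTd.trans (by omega)) (by rw [← coeff_zero_eq_eval_zero, hT0])
    (by
      rw [← coeff_zero_eq_eval_zero, coeff_derivative, zero_add, hT1]
      simp)
    -- The coefficient of `X` in `T` is nonzero and is multiplied by `ζ` under the rotation, so `ζ =
    -- 1`.
    (fun ζ _ h => by
      have h1 := congrArg (fun P => P.coeff 1) h
      simpa [coeff_twist, hT1] using h1)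
    hx (by simpa [hT] using hxy) hgen
    (isGalois_of_pow_add_mem hn hq (u := x)
      (by rw [← hxy]; exact pow_mem (mem_adjoin_simple_self K y) m)
      (eq_top_of_generators_mem hgen (subset_adjoin _ _ (Set.mem_insert _ _))
        (subset_adjoin _ _ (Set.mem_insert_of_mem _ (mem_adjoin_simple_self K y))))).1
    (isGalois_of_pow_add_mem hn hq (u := x⁻¹)
      (by rw [← hw']; exact pow_mem (mem_adjoin_simple_self K _) m)
      (by
        set E := adjoin K (insert x⁻¹ (K⟮y / x ^ N⟯ : Set C.FunctionField))
        have h1 : x ∈ E := inv_mem_iff.1 (subset_adjoin _ _ (Set.mem_insert _ _))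
        have h2 : y / x ^ N ∈ E :=
          subset_adjoin _ _ (Set.mem_insert_of_mem _ (mem_adjoin_simple_self K _))
        refine eq_top_of_generators_mem hgen h1 ?_
        rw [← div_mul_cancel₀ y (pow_ne_zero N hx0)]
        exact mul_mem h2 (pow_mem h1 N))).1
  refine ⟨φ, hφ, D, hbir, hdeg.trans hmN, coordPoint K 1, coordPoint K 2,
    fun h => absurd (coordPoint_injective h) (by decide), ⟨hg₁, ?_, 2, ?_⟩, ⟨hg₂, ?_, 1, ?_⟩⟩
  · change MvPolynomial.eval _ D.poly = 0
    rw [hpoly, eval_coordPoint_one_normForm hm hN (hTd.trans (by omega)), hmN, hTq1]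
  · rw [hpoly]
    refine eval_coordPoint_one_pderiv_normForm hm hN (hTd.trans (by omega)) ?_
    rw [hmN, Nat.add_sub_cancel, hTq]
    exact one_ne_zero
  · change MvPolynomial.eval _ D.poly = 0
    rw [hpoly, eval_coordPoint_two_normForm hm hN0, hT0]
  · rw [hpoly]
    refine eval_coordPoint_two_pderiv_normForm hm hN hT0 ?_
    rw [hT1]
    exact one_ne_zero

section Generators

variable {L : Type*} [Field L] [Algebra K L]

/-- The function field of `y ^ m = x ^ q + x` is also that of
`w ^ m = (z - 1) ^ (q + 1) + (c - 1)`. -/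
theorem exists_generators_shiftedFermat (hq : q = p ^ n) (hq2 : 2 < q) {m N : ℕ}
    (hmN : m * N = q + 1) {x y : L} (hx : Transcendental K x) (hxy : y ^ m = x ^ q + x)
    (hgen : adjoin K {x, y} = ⊤) {c d : K} (hd0 : d ≠ 0) (hd : d ^ (q + 1) = 1 - c) :
    ∃ z w : L, Transcendental K z ∧ w ^ m = aeval z (shiftedFermat q c) ∧
      adjoin K {z, w} = ⊤ := by
  have : CharP L p := charP_of_injective_algebraMap (algebraMap K L).injective p
  -- With `s = (z - (1 + d))⁻¹` one finds `T(z) * s ^ (q + 1) = (d * s) ^ q + d * s + 1`; the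
  -- translation `x = d * s - μ` absorbs the constant `1`.
  obtain ⟨μ, hμ⟩ : ∃ μ : K, μ ^ q + μ = -1 := by
    have hdeg : (X ^ q + (X + Polynomial.C 1) : K[X]).degree ≠ 0 := by
      rw [degree_add_eq_left_of_degree_lt] <;> rw [degree_X_pow]
      · exact_mod_cast (by omega : q ≠ 0)
      · rw [degree_X_add_C]
        exact_mod_cast (by omega : 1 < q)
    obtain ⟨μ, hμ⟩ := IsAlgClosed.exists_root _ hdeg
    refine ⟨μ, ?_⟩
    simp only [IsRoot.def, eval_add, eval_pow, eval_X, eval_C] at hμ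
    linear_combination hμ
  set ι := algebraMap K L with hι
  have hd0' : ι d ≠ 0 := by simpa [hι] using hd0
  obtain ⟨s, hs⟩ : ∃ s : L, s = (x + ι μ) / ι d := ⟨_, rfl⟩
  have hxs : x = ι d * s - ι μ := by
    rw [hs, mul_div_cancel₀ _ hd0']
    ring
  have hs0 : s ≠ 0 := by
    intro h
    refine hx ?_
    rw [hxs, h, mul_zero, zero_sub]
    exact (isAlgebraic_algebraMap μ).neg
  obtain ⟨z, hz⟩ : ∃ z : L, z = ι (1 + d) + s⁻¹ := ⟨_, rfl⟩
  have hsz : s = (z - ι (1 + d))⁻¹ := by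
    rw [hz, add_sub_cancel_left, inv_inv]
  have hy : y = y / s ^ N * s ^ N := (div_mul_cancel₀ _ (pow_ne_zero N hs0)).symm
  refine ⟨z, y / s ^ N, ?_, ?_, ?_⟩
  · intro h
    refine hx ?_
    rw [hxs, hsz]
    exact ((isAlgebraic_algebraMap d).mul (h.sub (isAlgebraic_algebraMap _)).inv).sub
      (isAlgebraic_algebraMap μ)
  · rw [aeval_shiftedFermat, div_pow, ← pow_mul, mul_comm N m, hmN, hxy,
      pow_add_eq_of_char (x := x) (d := ι d) (r := ι (1 + d)) (c := ι c) (μ := ι μ) (s := s) hq hd0'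
        (by rw [← map_pow, hd, map_sub, map_one]) (by rw [map_add, map_one])
        (by rw [← map_pow, ← map_add, hμ, map_neg, map_one]) hs hs0,
      mul_div_cancel_left₀ _ (pow_ne_zero _ hs0), hz]
  · set E := adjoin K {z, y / s ^ N}
    have hzm : z ∈ E := subset_adjoin _ _ (by simp)
    have hwm : y / s ^ N ∈ E := subset_adjoin _ _ (by simp)
    have hsm : s ∈ E := by
      rw [hsz]
      exact inv_mem (sub_mem hzm (E.algebraMap_mem _))
    refine eq_top_of_generators_mem hgen ?_ ?_
    · rw [hxs]
      exact sub_mem (mul_mem (E.algebraMap_mem _) hsm) (E.algebraMap_mem _)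
    · rw [hy]
      exact mul_mem hwm (pow_mem hsm N)

/-- The `(q + 1)`-th power of `z - 1` is `w ^ m - (c - 1)`, and `q + 1` is prime to `p`: a Kummer
extension. -/
theorem isGalois_shiftedFermat (hn : 0 < n) (hq : q = p ^ n) {m : ℕ} {c : K} {z w : L}
    (hz : Transcendental K z) (hw : w ^ m = aeval z (shiftedFermat q c))
    (hgen : adjoin K {z, w} = ⊤) : IsGalois K⟮w⟯ L := by
  have : CharP L p := charP_of_injective_algebraMap (algebraMap K L).injective p
  have hqK : ((q + 1 : ℕ) : K) ≠ 0 := by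
    rw [hq]
    simp [zero_pow hn.ne']
  have hu : (z - 1) ^ (q + 1) = w ^ m - algebraMap K L (c - 1) := by
    have hsub : (z - 1) ^ q = z ^ q - 1 := by rw [hq, sub_pow_char_pow, one_pow]
    rw [hw, aeval_shiftedFermat, pow_succ, hsub, map_sub, map_one]
    ring
  refine (isGalois_of_pow_mem (n := q + 1) (u := z - 1) hqK (fun h => hz ?_) ?_ ?_).1
  · rw [sub_eq_zero.1 h]
    exact isAlgebraic_one
  · rw [hu]
    exact sub_mem (pow_mem (mem_adjoin_simple_self K w) m) (K⟮w⟯.algebraMap_mem _)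
  · refine eq_top_of_generators_mem hgen ?_
      (subset_adjoin _ _ (Set.mem_insert_of_mem _ (mem_adjoin_simple_self K w)))
    have h := add_mem (subset_adjoin K (insert (z - 1) (K⟮w⟯ : Set L)) (Set.mem_insert _ _))
      (one_mem _)
    rwa [sub_add_cancel] at h

/-- Dividing `T(z)` by `z ^ (q + 1)` gives `1 - z⁻¹ - z⁻¹ ^ q + c * z⁻¹ ^ (q + 1)`. Because `c ^ q =
c`, this completes to `c * (z⁻¹ - c⁻¹) ^ (q + 1)` plus a constant, so `z⁻¹ - c⁻¹` is a Kummer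
generator. -/
theorem isGalois_shiftedFermat_div (hn : 0 < n) (hq : q = p ^ n) {m N : ℕ}
    (hmN : m * N = q + 1) {c : K} (hc0 : c ≠ 0) (hcq : c ^ q = c) {z w : L}
    (hz : Transcendental K z) (hw : w ^ m = aeval z (shiftedFermat q c))
    (hgen : adjoin K {z, w} = ⊤) : IsGalois K⟮w / z ^ N⟯ L := by
  have : CharP L p := charP_of_injective_algebraMap (algebraMap K L).injective p
  have hqK : ((q + 1 : ℕ) : K) ≠ 0 := by
    rw [hq]
    simp [zero_pow hn.ne']
  have hz0 : z ≠ 0 := fun h => hz (h ▸ isAlgebraic_zero)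
  have hc0' : algebraMap K L c ≠ 0 := by simpa using hc0
  have hu : (z⁻¹ - (algebraMap K L c)⁻¹) ^ (q + 1) =
      ((w / z ^ N) ^ m - algebraMap K L (1 - c⁻¹)) * algebraMap K L c⁻¹ := by
    have hsub : (z⁻¹ - (algebraMap K L c)⁻¹) ^ q = (z ^ q)⁻¹ - (algebraMap K L c)⁻¹ := by
      rw [← inv_pow, ← map_inv₀, hq, sub_pow_char_pow, ← hq, ← map_pow, inv_pow, inv_pow, hcq]
    have hzq : z ^ q ≠ 0 := pow_ne_zero q hz0
    rw [div_pow, ← pow_mul, mul_comm N m, hmN, hw, aeval_shiftedFermat, pow_succ, hsub, map_sub,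
      map_one, map_inv₀, pow_succ]
    generalize z ^ q = zq at *
    field_simp
    ring
  refine (isGalois_of_pow_mem (n := q + 1) (u := z⁻¹ - (algebraMap K L c)⁻¹) hqK
    (fun h => hz ?_) ?_ ?_).1
  · rw [inv_injective (sub_eq_zero.1 h)]
    exact isAlgebraic_algebraMap c
  · rw [hu]
    exact mul_mem (sub_mem (pow_mem (mem_adjoin_simple_self K _) m)
      (K⟮w / z ^ N⟯.algebraMap_mem _)) (K⟮w / z ^ N⟯.algebraMap_mem _)
  · set E := adjoin K (insert (z⁻¹ - (algebraMap K L c)⁻¹) (K⟮w / z ^ N⟯ : Set L))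
    have h0 : z⁻¹ - (algebraMap K L c)⁻¹ ∈ E := subset_adjoin _ _ (Set.mem_insert _ _)
    have h1 : z ∈ E := by
      have h := add_mem h0 (inv_mem (E.algebraMap_mem c))
      rw [sub_add_cancel] at h
      exact inv_mem_iff.1 h
    have h2 : w / z ^ N ∈ E :=
      subset_adjoin _ _ (Set.mem_insert_of_mem _ (mem_adjoin_simple_self K _))
    refine eq_top_of_generators_mem hgen h1 ?_
    rw [← div_mul_cancel₀ w (pow_ne_zero N hz0)]
    exact mul_mem h2 (pow_mem h1 N)

end Generators

/-- The model `w ^ m = (z - 1) ^ (q + 1) + (c - 1)` of the curve leads to two outer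
Galois points. -/
theorem exists_plane_model_outer {C : PlaneCurve K}
    (hres : ∀ (R : C.SmoothModel) (g : C.FunctionField), g ∈ R.1 →
      ∃ c, PlaneCurve.SmoothModel.HasValueAt g R c)
    (hfin : ∀ g : C.FunctionField, {R : C.SmoothModel | g ∉ R.1}.Finite)
    (hn : 0 < n) (hq : q = p ^ n) (hq2 : 2 < q) {m N : ℕ} (hm : 0 < m) (hN : (N : K) ≠ 0)
    (hmN : m * N = q + 1) {x y : C.FunctionField} (hx : Transcendental K x)
    (hxy : y ^ m = x ^ q + x) (hgen : adjoin K {x, y} = ⊤) :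
    ∃ φ : C.SmoothModel → Plane K, PlaneCurve.SmoothModel.IsMorphism φ ∧
      ∃ D : PlaneCurve K, PlaneCurve.SmoothModel.IsBirationalOnto φ D ∧ D.degree = q + 1 ∧
        ∃ P₁ P₂ : Plane K, P₁ ≠ P₂ ∧ D.IsOuterGaloisPoint P₁ ∧ D.IsOuterGaloisPoint P₂ := by
  have hN0 : 0 < N := Nat.pos_of_ne_zero fun h => hN (by rw [h, Nat.cast_zero])
  obtain ⟨c, hcq, hc0, hc1⟩ := exists_pow_eq_self_ne (K := K) hn hq hq2
  -- This makes `1 + d` a root of `T`, simple because the derivative there is `d ^ q` and `c ≠ 1`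
  -- gives `d ≠ 0`.
  obtain ⟨d, hd⟩ := IsAlgClosed.exists_pow_nat_eq (1 - c) (Nat.succ_pos q)
  have hd0 : d ≠ 0 := by
    rintro rfl
    rw [zero_pow (Nat.succ_ne_zero q)] at hd
    exact hc1 (sub_eq_zero.1 hd.symm).symm
  obtain ⟨z, w, hz, hw, hgen'⟩ :=
    exists_generators_shiftedFermat hq hq2 hmN hx hxy hgen hd0 hd
  obtain ⟨hTq1, hT1, hT0⟩ := coeff_shiftedFermat hq2 c
  have hTd : (shiftedFermat q c).natDegree ≤ m * N := hmN ▸ natDegree_shiftedFermat_le hq2 c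
  obtain ⟨φ, hφ, D, hbir, hpoly, hdeg, hg₁, hg₂⟩ := exists_plane_model hres hfin hm hN hTd
    (eval_shiftedFermat hq hd)
    (by
      rw [eval_derivative_shiftedFermat hn hq]
      exact pow_ne_zero q hd0)
    (fun ζ _ h => by
      have h1 := congrArg (fun P => P.coeff 1) h
      simpa [coeff_twist, hT1] using h1)
    hz hw hgen' (isGalois_shiftedFermat hn hq hz hw hgen')
    (isGalois_shiftedFermat_div hn hq hmN hc0 hcq hz hw hgen')
  refine ⟨φ, hφ, D, hbir, hdeg.trans hmN, coordPoint K 1, coordPoint K 2,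
    fun h => absurd (coordPoint_injective h) (by decide), ⟨hg₁, ?_⟩, ⟨hg₂, ?_⟩⟩
  · change ¬ MvPolynomial.eval _ D.poly = 0
    rw [hpoly, eval_coordPoint_one_normForm hm hN hTd, hmN, hTq1]
    exact one_ne_zero
  · change ¬ MvPolynomial.eval _ D.poly = 0
    rw [hpoly, eval_coordPoint_two_normForm hm hN0, hT0]
    exact hc0

end Polynomials

variable [IsAlgClosed K]

/-- Residue fields and poles on the smooth model of a curve `y ^ m = f` with `f` in `K(x)`. -/
theorem smoothModel_residue_and_poles {C : PlaneCurve K} {m : ℕ} (hm : (m : K) ≠ 0)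
    {x y : C.FunctionField} (hy0 : y ≠ 0) (hxy : y ^ m ∈ K⟮x⟯) (hgen : adjoin K {x, y} = ⊤) :
    (∀ (R : C.SmoothModel) (g : C.FunctionField), g ∈ R.1 →
      ∃ c, PlaneCurve.SmoothModel.HasValueAt g R c) ∧
    (∀ g : C.FunctionField, {R : C.SmoothModel | g ∉ R.1}.Finite) := by
  obtain ⟨hgal, hfd⟩ := isGalois_of_pow_mem (S := K⟮x⟯) hm hy0 hxy
    (eq_top_of_generators_mem hgen
      (subset_adjoin _ _ (Set.mem_insert_of_mem _ (mem_adjoin_simple_self K x)))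
      (subset_adjoin _ _ (Set.mem_insert _ _)))
  constructor
  · intro R g hg
    exact exists_valuation_sub_algebraMap_lt_one
      (fun _ h => isAlgebraic_adjoin_simple_of_transcendental (x := x) h) R.2.1 R.2.2 hg
  · intro g
    refine ((finite_setOf_notMem_valuationSubring_of_simple (K := K) x g).preimage
      (f := fun R : C.SmoothModel => R.1) Subtype.val_injective.injOn).subset ?_
    intro R hR
    exact ⟨R.2.1, R.2.2, hR⟩

end Final

end GaloisPoints

end

theorem theorem1 {K : Type*} [Field K] [IsAlgClosed K] (p : ℕ) (hp : p.Prime) [CharP K p]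
    (n : ℕ) (hn : 0 < n) (q : ℕ) (hq : q = p ^ n)
    (m : ℕ) (hmdvd : m ∣ q + 1) (hm : 2 ≤ m) (hmq : m < q) :
    (∃ φ : (GaloisPoints.artinSchreierCurve K q m hm hmq).SmoothModel → GaloisPoints.Plane K,
      GaloisPoints.PlaneCurve.SmoothModel.IsMorphism φ ∧
      ∃ D : GaloisPoints.PlaneCurve K,
        GaloisPoints.PlaneCurve.SmoothModel.IsBirationalOnto φ D ∧
        D.degree = q + 1 ∧
        ∃ P₁ P₂ : GaloisPoints.Plane K, P₁ ≠ P₂ ∧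
          D.IsInnerGaloisPoint P₁ ∧ D.IsInnerGaloisPoint P₂) ∧
    (∃ ψ : (GaloisPoints.artinSchreierCurve K q m hm hmq).SmoothModel → GaloisPoints.Plane K,
      GaloisPoints.PlaneCurve.SmoothModel.IsMorphism ψ ∧
      ∃ D : GaloisPoints.PlaneCurve K,
        GaloisPoints.PlaneCurve.SmoothModel.IsBirationalOnto ψ D ∧
        D.degree = q + 1 ∧
        ∃ P₁ P₂ : GaloisPoints.Plane K, P₁ ≠ P₂ ∧
          D.IsOuterGaloisPoint P₁ ∧ D.IsOuterGaloisPoint P₂) := by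
  have : Fact p.Prime := ⟨hp⟩
  obtain ⟨N, hmN⟩ := hmdvd
  -- In `K` the number `q + 1` is `1`, so `m` and `N` are invertible there.
  have hprod : (m : K) * (N : K) = 1 := by
    rw [← Nat.cast_mul, ← hmN, Nat.cast_add, hq, Nat.cast_pow, CharP.cast_eq_zero,
      zero_pow hn.ne', zero_add, Nat.cast_one]
  have hmK : (m : K) ≠ 0 := left_ne_zero_of_mul_eq_one hprod
  have hNK : (N : K) ≠ 0 := right_ne_zero_of_mul_eq_one hprod
  obtain ⟨x, y, hx, hxy, hgen⟩ := GaloisPoints.exists_generators_artinSchreierCurve (K := K) hm hmq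
  have hy0 : y ≠ 0 := by
    rintro rfl
    rw [zero_pow (by omega)] at hxy
    refine hx ⟨Polynomial.X ^ q + Polynomial.X, fun h => ?_, by simp [hxy]⟩
    have h1 := congrArg (fun P => P.coeff 1) h
    simp [Polynomial.coeff_X_pow, show 1 ≠ q by omega] at h1
  have hxmem := IntermediateField.mem_adjoin_simple_self K x
  obtain ⟨hres, hfin⟩ := GaloisPoints.smoothModel_residue_and_poles hmK hy0
    (by rw [hxy]; exact add_mem (pow_mem hxmem q) hxmem) hgen
  exact ⟨GaloisPoints.exists_plane_model_inner hres hfin hn hq (by omega) (by omega) hNK hmN.symm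
      hx hxy hgen,
    GaloisPoints.exists_plane_model_outer hres hfin hn hq (by omega) (by omega) hNK hmN.symm
      hx hxy hgen⟩
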